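/- Let $(\mathfrak g,\langle\cdot,\cdot\rangle)$ be a metric Lie algebra of dimension $3$, i.e. a $3$-dimensional real Lie algebra with a positive definite inner product. For $Y\in\mathfrak g$ let $\mathrm{ad}^t_Y$ be the adjoint of $\mathrm{ad}_Y$ with respect to the inner product. Consider the Euler equation $\dot Y=\mathrm{ad}^t_Y Y$ on $\mathfrak g$. A stationary point $X$ (i.e. $\mathrm{ad}^t_X X=0$) is called stable if it is Lyapunov stable: for every $\varepsilon>0$ there is $\delta>0$ such that every solution $Y$ with $\|Y(0)-X\|<\delta$ satisfies $\|Y(t)-X\|<\varepsilon$ for all $t\ge 0$; otherwise it is called unstable. Let $\mathcal J_X$, $\mathcal J_X Y=\mathrm{ad}^t_XY+\mathrm{ad}^t_YX$, be the linearisation of the right-hand side at $X$, and let $\sigma_k(\mathcal J_X)$ be the $k$-th elementary symmetric function of its eigenvalues. (A) A stationary point $X$ is stable if and only if either (i) $\mathcal J_X=0$, or (ii) $\sigma_2(\mathcal J_X)\ge 0\ge\sigma_1(\mathcal J_X)$, with at least one of the two inequalities being strict. (B) There is always a nonzero stable stationary point. There is an unstable stationary point if and only if it is not the case that either $\mathfrak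 g$ is abelian, or $\mathfrak g$ is isomorphic to $\mathfrak{so}(3)$ and the inner product is bi-invariant (i.e. $\mathrm{ad}_Z$ is skew-symmetric for all $Z\in\mathfrak g$). -/

import Mathlib

/-- A metric Lie algebra: a real Lie algebra with a (positive definite) inner product.
The additive group and the real vector space structure of the two parts are shared. -/
class MetricLieAlgebra (𝔤 : Type*) extends
  NormedAddCommGroup 𝔤, InnerProductSpace ℝ 𝔤, LieRing 𝔤, LieAlgebra ℝ 𝔤

namespace MetricLieAlgebra

noncomputable section

/-- The elementary symmetric function `σ_k`, for `k ≤ dim V`, of the eigenvalues of an endomorphism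
`f` of `V`, read off from `det (l - f) = ∑ (-1) ^ k σ_k (f) l ^ (dim V - k)`. -/
def sigma {V : Type*} [AddCommGroup V] [Module ℝ V] [FiniteDimensional ℝ V]
    (k : ℕ) (f : V →ₗ[ℝ] V) : ℝ :=
  (-1) ^ k * f.charpoly.coeff (Module.finrank ℝ V - k)

/-- `sigma k f` is the `k`-th elementary symmetric function of the complex eigenvalues of `f`,
counted with algebraic multiplicity. -/
theorem sigma_eq_esymm {V : Type*} [AddCommGroup V] [Module ℝ V] [FiniteDimensional ℝ V]
    (k : ℕ) (hk : k ≤ Module.finrank ℝ V) (f : V →ₗ[ℝ] V) :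
    (sigma k f : ℂ) = (f.charpoly.map (algebraMap ℝ ℂ)).roots.esymm k := by
  have hm : (f.charpoly.map (algebraMap ℝ ℂ)).Monic := f.charpoly_monic.map _
  have hd : (f.charpoly.map (algebraMap ℝ ℂ)).natDegree = Module.finrank ℝ V := by
    rw [f.charpoly_monic.natDegree_map, f.charpoly_natDegree]
  have h := Polynomial.coeff_eq_esymm_roots_of_card
    (p := f.charpoly.map (algebraMap ℝ ℂ))
    ((IsAlgClosed.splits _).natDegree_eq_card_roots.symm)
    (k := Module.finrank ℝ V - k) (by omega)
  rw [hd, hm.leadingCoeff, Nat.sub_sub_self hk, one_mul, Polynomial.coeff_map] at h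
  have h' : ((f.charpoly.coeff (Module.finrank ℝ V - k) : ℝ) : ℂ)
      = (-1) ^ k * (f.charpoly.map (algebraMap ℝ ℂ)).roots.esymm k := h
  rw [sigma, Complex.ofReal_mul, h', ← mul_assoc]
  simp [← mul_pow]

variable {𝔤 : Type*} [MetricLieAlgebra 𝔤] [FiniteDimensional ℝ 𝔤]

/-- The metric adjoint `ad^t_Y` of the operator `ad_Y`. -/
def adT (Y : 𝔤) : 𝔤 →ₗ[ℝ] 𝔤 := LinearMap.adjoint (LieAlgebra.ad ℝ 𝔤 Y)

theorem inner_adT (X Y Z : 𝔤) : inner ℝ (adT X Y) Z = inner ℝ Y ⁅X, Z⁆ :=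
  LinearMap.adjoint_inner_left _ _ _

/-- The right-hand side `ad^t_Y Y` of the Euler equation. -/
def eulerField (Y : 𝔤) : 𝔤 := adT Y Y

/-- `Y : ℝ → 𝔤` is a solution, defined for all times, of the Euler equation `Y' = ad^t_Y Y`. -/
def IsEulerSolution (Y : ℝ → 𝔤) : Prop := ∀ t : ℝ, HasDerivAt Y (eulerField (Y t)) t

/-- Stationary points of the Euler equation. -/
def IsStationary (X : 𝔤) : Prop := eulerField X = 0

/-- Lyapunov stability of a stationary point. Solutions of the Euler equation have constant norm,
hence exist for all times. -/
def IsStable (X : 𝔤) : Prop :=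
  ∀ ε > 0, ∃ δ > 0, ∀ Y : ℝ → 𝔤, IsEulerSolution Y → ‖Y 0 - X‖ < δ →
    ∀ t, 0 ≤ t → ‖Y t - X‖ < ε

/-- The linearisation `𝒥_X Y = ad^t_X Y + ad^t_Y X` of the Euler equation at `X`. -/
def linearisation (X : 𝔤) : 𝔤 →ₗ[ℝ] 𝔤 where
  toFun Y := adT X Y + adT Y X
  map_add' Y Z := by
    simp only [adT, map_add, LinearMap.add_apply]; abel
  map_smul' c Y := by
    simp [adT]

/-- `linearisation X` is the derivative at `X` of the right-hand side of the Euler equation. -/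
theorem hasFDerivAt_eulerField (X : 𝔤) :
    HasFDerivAt eulerField (LinearMap.toContinuousLinearMap (linearisation X)) X := by
  let L : 𝔤 →ₗ[ℝ] 𝔤 →ₗ[ℝ] 𝔤 :=
    { toFun := adT
      map_add' := fun Y Z => by simp only [adT, map_add]
      map_smul' := fun c Y => by simp [adT] }
  let B : 𝔤 →L[ℝ] 𝔤 →L[ℝ] 𝔤 := LinearMap.toContinuousLinearMap
    ((LinearMap.toContinuousLinearMap : (𝔤 →ₗ[ℝ] 𝔤) ≃ₗ[ℝ] (𝔤 →L[ℝ] 𝔤)).toLinearMap ∘ₗ L)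
  have h := B.hasFDerivAt_of_bilinear (hasFDerivAt_id X) (hasFDerivAt_id X)
  refine h.congr_fderiv ?_
  ext Y
  rfl

variable (𝔤) in
/-- The inner product is bi-invariant: every `ad_Z` is skew-symmetric. -/
def IsBiInvariant : Prop :=
  ∀ X Y Z : 𝔤, inner ℝ ⁅Z, X⁆ Y + inner ℝ X ⁅Z, Y⁆ = 0

end

end MetricLieAlgebra

section

open Set Filter Topology
open scoped NNReal

/-! The Euler field is quadratic and orthogonal to its argument. Norms are therefore conserved, the
origin is stable, and solutions are global, so that initial data of escaping solutions are really
attained.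

At a stationary X ≠ 0 with a = ‖X‖, choose an orthonormal frame with b₀ = X/a and rotate b₁, b₂
until [b₁, b₂] has no b₂-component. In coordinates (x, y, z) with w = (y, z), the equation reads w'
= x M w + ν y (-z, y), where M = (p q; r s), and x is controlled by the conserved norm. The
linearisation is a M on b₀^⊥ and zero on b₀, so σ₁ = a tr M and σ₂ = a² det M. The Jacobi identity
leaves two cases: ν = 0, or s = 0 and pq = 0.

If ν = 0, the motion of w is, while x > 0, a linear flow with changed time. Quadratic Lyapunov
functions, a positive eigenvalue or a nilpotent drift decide. If ν ≠ 0 and p ≠ 0, then q = s = 0 and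
y is damped or amplified according to the sign of p. If p = s = 0, the sign of qr separates a
saddle, a degenerate case and a center. The center is beyond linear methods: there (x, y) follows a
linear flow line, along which x² + y² has a strict local minimum, and conservation of the norm
confines it. These cases are assembled in `reducedStable_or_reducedUnstable`, which gives (A)
through `isStable_iff`.

For (B), a unimodular algebra has Milnor's diagonal frame (`exists_isDiagonalFrame`), where σ₁ = 0
and σ₂ at each axis is a product of two differences of the structure constants. As for a rigid body,
extreme axes are stable and middle ones unstable, unless all constants agree. Otherwise Y ↦ tr ad_Y
is represented by a vector whose direction is unstable. Its opposite is stable, or else some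
isotropic vector orthogonal to it is. -/

/-! ### Monotonicity, growth and continuous induction on the half-line -/

theorem le_of_hasDerivAt_nonneg {V V' : ℝ → ℝ} (hV : ∀ t, HasDerivAt V (V' t) t) {t : ℝ}
    (ht : 0 ≤ t) (h : ∀ u ∈ Icc 0 t, 0 ≤ V' u) : V 0 ≤ V t := by
  have hm : MonotoneOn V (Icc 0 t) := by
    refine monotoneOn_of_deriv_nonneg (convex_Icc 0 t)
      (fun u _ => (hV u).continuousAt.continuousWithinAt)
      (fun u _ => (hV u).differentiableAt.differentiableWithinAt) fun u hu => ?_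
    rw [interior_Icc] at hu
    rw [(hV u).deriv]
    exact h u (Ioo_subset_Icc_self hu)
  exact hm (left_mem_Icc.2 ht) (right_mem_Icc.2 ht) ht

theorem le_of_hasDerivAt_nonpos {V V' : ℝ → ℝ} (hV : ∀ t, HasDerivAt V (V' t) t) {t : ℝ}
    (ht : 0 ≤ t) (h : ∀ u ∈ Icc 0 t, V' u ≤ 0) : V t ≤ V 0 := by
  have := le_of_hasDerivAt_nonneg (V := fun t => -V t) (V' := fun t => -V' t)
    (fun u => (hV u).neg) ht fun u hu => by have := h u hu; linarith
  linarith

theorem eq_of_hasDerivAt_zero {V V' : ℝ → ℝ} (hV : ∀ t, HasDerivAt V (V' t) t)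
    (h : ∀ t, V' t = 0) (t : ℝ) : V t = V 0 :=
  is_const_of_deriv_eq_zero (fun t => (hV t).differentiableAt)
    (fun t => by rw [(hV t).deriv, h]) t 0

/-- A function whose derivative is bounded below by a positive constant is unbounded. -/
theorem exists_gt_of_le_hasDerivAt {U U' : ℝ → ℝ} (hU : ∀ t, HasDerivAt U (U' t) t) {η : ℝ}
    (hη : 0 < η) (h : ∀ t, 0 ≤ t → η ≤ U' t) (C : ℝ) : ∃ t, 0 ≤ t ∧ C < U t := by
  have key : ∀ t, 0 ≤ t → U 0 + η * t ≤ U t := fun t ht => by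
    have := le_of_hasDerivAt_nonneg (V := fun t => U t - η * t) (V' := fun t => U' t - η * 1)
      (fun u => (hU u).sub ((hasDerivAt_id u).const_mul η)) ht
      fun u hu => by have := h u hu.1; linarith
    simp only [mul_zero, sub_zero] at this
    linarith
  refine ⟨(|C - U 0| + 1) / η, by positivity, ?_⟩
  have h1 := key ((|C - U 0| + 1) / η) (by positivity)
  rw [mul_div_cancel₀ _ hη.ne'] at h1
  linarith [le_abs_self (C - U 0)]

/-- A function with `c V ≤ V'`, `c > 0`, and positive initial value is unbounded. -/
theorem exists_gt_of_mul_le_hasDerivAt {V V' : ℝ → ℝ} (hV : ∀ t, HasDerivAt V (V' t) t) {c : ℝ}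
    (hc : 0 < c) (h : ∀ t, 0 ≤ t → c * V t ≤ V' t) (h0 : 0 < V 0) (C : ℝ) :
    ∃ t, 0 ≤ t ∧ C < V t := by
  have hge : ∀ t, 0 ≤ t → V 0 ≤ V t := fun t ht => by
    have h1 := le_of_hasDerivAt_nonneg (V := fun t => Real.exp (-(c * t)) * V t)
      (V' := fun t => Real.exp (-(c * t)) * -(c * 1) * V t + Real.exp (-(c * t)) * V' t)
      (fun u => ((((hasDerivAt_id u).const_mul c).neg).exp).mul (hV u)) ht
      fun u hu => by
        have := mul_le_mul_of_nonneg_left (h u hu.1) (Real.exp_pos (-(c * u))).le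
        linarith
    simp only [mul_zero, neg_zero, Real.exp_zero, one_mul] at h1
    have hpos : 0 < V t := by
      by_contra hn
      have := mul_nonpos_of_nonneg_of_nonpos (Real.exp_pos (-(c * t))).le (not_lt.1 hn)
      linarith
    have : Real.exp (-(c * t)) * V t ≤ 1 * V t :=
      mul_le_mul_of_nonneg_right (Real.exp_le_one_iff.2 (by nlinarith)) hpos.le
    linarith
  refine exists_gt_of_le_hasDerivAt hV (mul_pos hc h0) (fun t ht => ?_) C
  exact (mul_le_mul_of_nonneg_left (hge t ht) hc.le).trans (h t ht)

/-- Continuous induction: a quantity that cannot vanish as long as it has been nonnegative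
stays positive. -/
theorem pos_of_continuous_of_ne_zero {g : ℝ → ℝ} (hg : Continuous g) (h0 : 0 < g 0)
    (h : ∀ t, 0 ≤ t → (∀ u ∈ Icc 0 t, 0 ≤ g u) → g t ≠ 0) : ∀ t, 0 ≤ t → 0 < g t := by
  intro t ht
  by_contra hneg
  let S := Icc 0 t ∩ {u | g u ≤ 0}
  have hS : IsCompact S := isCompact_Icc.inter_right (isClosed_le hg continuous_const)
  obtain ⟨T, ⟨⟨hT0, hTt⟩, hT⟩, hmin⟩ := hS.exists_isLeast ⟨t, ⟨ht, le_rfl⟩, not_lt.1 hneg⟩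
  have hpos : ∀ u, 0 ≤ u → u < T → 0 < g u := fun u hu huT => by
    by_contra hn
    exact absurd (hmin ⟨⟨hu, huT.le.trans hTt⟩, not_lt.1 hn⟩) (not_le.2 huT)
  have hT' : 0 < T := lt_of_le_of_ne hT0 fun h => by
    rw [← h] at hT
    exact absurd hT (not_le.2 h0)
  have hge : 0 ≤ g T := by
    have hc : g T ∈ closure (Ioi 0) := by
      refine mem_closure_of_tendsto (b := 𝓝[<] T) (hg.continuousAt.tendsto.mono_left inf_le_left) ?_
      filter_upwards [Ioo_mem_nhdsLT hT'] with u hu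
      exact hpos u hu.1.le hu.2
    rwa [closure_Ioi, mem_Ici] at hc
  refine h T hT0 (fun u hu => ?_) (le_antisymm hT hge)
  rcases hu.2.lt_or_eq with hlt | heq
  · exact (hpos u hu.1 hlt).le
  · rw [heq]; exact hge

/-- A continuous function vanishing at `(a, 0, 0)` is small nearby. -/
theorem exists_delta_of_continuous {Φ : ℝ → ℝ → ℝ → ℝ}
    (hΦ : Continuous fun v : ℝ × ℝ × ℝ => Φ v.1 v.2.1 v.2.2) {a : ℝ} (h0 : Φ a 0 0 = 0) {η : ℝ}
    (hη : 0 < η) : ∃ δ > 0, ∀ x y z : ℝ, |x - a| < δ → |y| < δ → |z| < δ → |Φ x y z| < η := by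
  obtain ⟨δ, hδ, h⟩ := Metric.continuous_iff.1 hΦ (a, 0, 0) η hη
  refine ⟨δ, hδ, fun x y z hx hy hz => ?_⟩
  have := h (x, y, z) (by simp [Prod.dist_eq, Real.dist_eq, hx, hy, hz])
  simpa [h0, Real.dist_eq] using this

theorem abs_sub_le_of_sq {x a : ℝ} (ha : 0 < a) (hx : 0 ≤ x) : |x - a| ≤ |x ^ 2 - a ^ 2| / a := by
  rw [le_div_iff₀ ha, show x ^ 2 - a ^ 2 = (x - a) * (x + a) by ring, abs_mul,
    abs_of_pos (show 0 < x + a by linarith)]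
  exact mul_le_mul_of_nonneg_left (by linarith) (abs_nonneg _)

/-- Solutions of the Euler equation in an orthonormal frame adapted to a stationary point on the
first axis. -/
structure ReducedSolution (p q r s ν : ℝ) (x y z : ℝ → ℝ) : Prop where
  fst : ∀ t, HasDerivAt x (-(p * y t ^ 2 + (q + r) * y t * z t + s * z t ^ 2)) t
  snd : ∀ t, HasDerivAt y (x t * (p * y t + q * z t) - ν * y t * z t) t
  trd : ∀ t, HasDerivAt z (x t * (r * y t + s * z t) + ν * y t ^ 2) t

/-- Lyapunov stability of `(a, 0, 0)` for the reduced system. -/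
def ReducedStable (p q r s ν a : ℝ) : Prop :=
  ∀ ε > 0, ∃ δ > 0, ∀ x y z : ℝ → ℝ, ReducedSolution p q r s ν x y z →
    |x 0 - a| < δ → |y 0| < δ → |z 0| < δ → ∀ t, 0 ≤ t → |x t - a| < ε ∧ |y t| < ε ∧ |z t| < ε

/-- Arbitrarily close to `(a, 0, 0)` there are initial values from which every solution of the
reduced system leaves a fixed neighbourhood. -/
def ReducedUnstable (p q r s ν a : ℝ) : Prop :=
  ∃ ε > 0, ∀ δ > 0, ∃ x₀ y₀ z₀ : ℝ, |x₀ - a| < δ ∧ |y₀| < δ ∧ |z₀| < δ ∧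
    ∀ x y z : ℝ → ℝ, ReducedSolution p q r s ν x y z → x 0 = x₀ → y 0 = y₀ → z 0 = z₀ →
      ¬ ∀ t, 0 ≤ t → |x t - a| < ε ∧ |y t| < ε ∧ |z t| < ε

namespace ReducedSolution

variable {p q r s ν : ℝ} {x y z : ℝ → ℝ}

theorem normSq_eq (h : ReducedSolution p q r s ν x y z) (t : ℝ) :
    x t ^ 2 + y t ^ 2 + z t ^ 2 = x 0 ^ 2 + y 0 ^ 2 + z 0 ^ 2 :=
  eq_of_hasDerivAt_zero (V := fun t => x t ^ 2 + y t ^ 2 + z t ^ 2)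
    (fun t => (((h.fst t).pow 2).add ((h.snd t).pow 2)).add ((h.trd t).pow 2))
    (fun t => by push_cast; ring) t

theorem hasDerivAt_linear (h : ReducedSolution p q r s ν x y z) (l m n t : ℝ) :
    HasDerivAt (fun t => l * x t + m * y t + n * z t)
      (l * (-(p * y t ^ 2 + (q + r) * y t * z t + s * z t ^ 2)) +
        m * (x t * (p * y t + q * z t) - ν * y t * z t) +
        n * (x t * (r * y t + s * z t) + ν * y t ^ 2)) t :=
  (((h.fst t).const_mul l).add ((h.snd t).const_mul m)).add ((h.trd t).const_mul n)

theorem continuous_fst (h : ReducedSolution p q r s ν x y z) : Continuous x :=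
  continuous_iff_continuousAt.2 fun t => (h.fst t).continuousAt

theorem continuous_snd (h : ReducedSolution p q r s ν x y z) : Continuous y :=
  continuous_iff_continuousAt.2 fun t => (h.snd t).continuousAt

theorem continuous_trd (h : ReducedSolution p q r s ν x y z) : Continuous z :=
  continuous_iff_continuousAt.2 fun t => (h.trd t).continuousAt

end ReducedSolution

/-! ### Instability of the reduced system -/

section Unstable

variable {p q r s ν a : ℝ}

/-- (l, m) is a left eigenvector of M, so u = l y + m z satisfies u' = μ x u, and u² grows
exponentially as long as x > a/2. -/
theorem reducedUnstable_of_eigenvalue (ha : 0 < a) {l m μ : ℝ} (hl : l * p + m * r = μ * l)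
    (hm : l * q + m * s = μ * m) (hμ : 0 < μ) (hlm : 0 < l ^ 2 + m ^ 2) :
    ReducedUnstable p q r s 0 a := by
  refine ⟨a / 2, by positivity, fun δ hδ => ?_⟩
  -- Scaled so that both κ|l| and κ|m| are below δ; the summand 1 avoids a zero denominator.
  set κ := δ / (2 * (|l| + |m| + 1)) with hκ
  have hκ0 : 0 < κ := by positivity
  have hκ1 : κ * (2 * (|l| + |m| + 1)) = δ := div_mul_cancel₀ _ (by positivity)
  refine ⟨a, κ * l, κ * m, by simpa, ?_, ?_, fun x y z h hx hy hz hb => ?_⟩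
  · rw [abs_mul, abs_of_pos hκ0]; nlinarith [abs_nonneg l, abs_nonneg m]
  · rw [abs_mul, abs_of_pos hκ0]; nlinarith [abs_nonneg l, abs_nonneg m]
  · have hV : ∀ t, HasDerivAt (fun t => (0 * x t + l * y t + m * z t) ^ 2)
        (2 * (x t * μ) * (l * y t + m * z t) ^ 2) t := fun t =>
      ((h.hasDerivAt_linear 0 l m t).pow 2).congr_deriv (by
        push_cast
        linear_combination (2 * (l * y t + m * z t) * x t * y t) * hl +
          (2 * (l * y t + m * z t) * x t * z t) * hm)
    obtain ⟨t, ht, hlt⟩ := exists_gt_of_mul_le_hasDerivAt hV (mul_pos ha hμ) (fun t ht => by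
      have h1 := (abs_lt.1 (hb t ht).1).1
      have h2 : 0 ≤ (2 * x t - a) * (μ * (l * y t + m * z t) ^ 2) :=
        mul_nonneg (by linarith) (by positivity)
      linarith) (by
      rw [hy, hz]
      have : 0 * x 0 + l * (κ * l) + m * (κ * m) = κ * (l ^ 2 + m ^ 2) := by ring
      rw [this]; positivity) ((l ^ 2 + m ^ 2) * (2 * (a / 2) ^ 2))
    have h2 := sq_lt_sq' (abs_lt.1 (hb t ht).2.1).1 (abs_lt.1 (hb t ht).2.1).2
    have h3 := sq_lt_sq' (abs_lt.1 (hb t ht).2.2).1 (abs_lt.1 (hb t ht).2.2).2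
    have h4 : (0 * x t + l * y t + m * z t) ^ 2 ≤ (l ^ 2 + m ^ 2) * (y t ^ 2 + z t ^ 2) := by
      nlinarith [sq_nonneg (l * z t - m * y t)]
    have h5 := mul_lt_mul_of_pos_left (add_lt_add h2 h3) hlm
    linarith

/-- The eigenvalues may be complex, so a quadratic form replaces the eigenvector. With d = det M,
the form d|w|² + |adj(M) w|² solves the Lyapunov equation: since adj(M) M = d and M + adj(M) = tr M,
its derivative is 2 x d tr(M) |w|². -/
theorem reducedUnstable_of_trace_pos_of_det_pos (ha : 0 < a) (ht : 0 < p + s)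
    (hd : 0 < p * s - q * r) : ReducedUnstable p q r s 0 a := by
  refine ⟨a / 2, by positivity, fun δ hδ => ⟨a, δ / 2, 0, by simpa, ?_, by simpa,
    fun x y z h hx hy hz hb => ?_⟩⟩
  · rw [abs_of_pos (by positivity)]; linarith
  set d := p * s - q * r with hd'
  set K := d + (p ^ 2 + q ^ 2 + r ^ 2 + s ^ 2) with hK
  have hK0 : 0 < K := by positivity
  have hV : ∀ t, HasDerivAt (fun t => d * (y t ^ 2 + z t ^ 2) +
      ((0 * x t + s * y t + -q * z t) ^ 2 + (0 * x t + -r * y t + p * z t) ^ 2))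
      (2 * (x t * (p + s) * d * (y t ^ 2 + z t ^ 2))) t := fun t =>
    (((((h.snd t).pow 2).add ((h.trd t).pow 2)).const_mul d).add
      (((h.hasDerivAt_linear 0 s (-q) t).pow 2).add
      ((h.hasDerivAt_linear 0 (-r) p t).pow 2))).congr_deriv (by push_cast; rw [hd']; ring)
  have hW : ∀ t, d * (y t ^ 2 + z t ^ 2) + ((0 * x t + s * y t + -q * z t) ^ 2 +
      (0 * x t + -r * y t + p * z t) ^ 2) ≤ K * (y t ^ 2 + z t ^ 2) := fun t => by
    rw [hK]
    nlinarith [sq_nonneg (s * z t + q * y t), sq_nonneg (r * z t + p * y t)]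
  obtain ⟨t, ht, hlt⟩ := exists_gt_of_mul_le_hasDerivAt hV
    (show 0 < a * (p + s) * d / K by positivity) (fun t ht' => by
    have h1 := (abs_lt.1 (hb t ht').1).1
    have h2 : 0 ≤ (2 * x t - a) * ((p + s) * d * (y t ^ 2 + z t ^ 2)) :=
      mul_nonneg (by linarith) (by positivity)
    calc _ ≤ a * (p + s) * d / K * (K * (y t ^ 2 + z t ^ 2)) :=
          mul_le_mul_of_nonneg_left (hW t) (by positivity)
      _ = a * (p + s) * d * (y t ^ 2 + z t ^ 2) := by field_simp
      _ ≤ _ := by linarith) (by rw [hy, hz]; positivity) (K * (2 * (a / 2) ^ 2))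
  have h2 := sq_lt_sq' (abs_lt.1 (hb t ht).2.1).1 (abs_lt.1 (hb t ht).2.1).2
  have h3 := sq_lt_sq' (abs_lt.1 (hb t ht).2.2).1 (abs_lt.1 (hb t ht).2.2).2
  have h5 := mul_lt_mul_of_pos_left (add_lt_add h2 h3) hK0
  linarith [hW t]

/-- By Cayley–Hamilton M² = 0, so M w is constant along solutions. If it is nonzero, w drifts in its
direction with speed proportional to x. -/
theorem reducedUnstable_of_nilpotent (ha : 0 < a) (ht : p + s = 0) (hd : p * s - q * r = 0)
    (hM : ¬ (p = 0 ∧ q = 0 ∧ r = 0 ∧ s = 0)) : ReducedUnstable p q r s 0 a := by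
  obtain ⟨l, m, hlm⟩ : ∃ l m : ℝ, 0 < (p * l + q * m) ^ 2 + (r * l + s * m) ^ 2 := by
    by_contra! hn
    have h1 := hn 1 0
    have h2 := hn 0 1
    simp only [mul_one, mul_zero, add_zero, zero_add] at h1 h2
    exact hM ⟨by nlinarith, by nlinarith, by nlinarith, by nlinarith⟩
  refine ⟨a / 2, by positivity, fun δ hδ => ?_⟩
  set κ := δ / (2 * (|l| + |m| + 1)) with hκ
  have hκ0 : 0 < κ := by positivity
  have hκ1 : κ * (2 * (|l| + |m| + 1)) = δ := div_mul_cancel₀ _ (by positivity)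
  refine ⟨a, κ * l, κ * m, by simpa, ?_, ?_, fun x y z h hx hy hz hb => ?_⟩
  · rw [abs_mul, abs_of_pos hκ0]; nlinarith [abs_nonneg l, abs_nonneg m]
  · rw [abs_mul, abs_of_pos hκ0]; nlinarith [abs_nonneg l, abs_nonneg m]
  have hv : ∀ t, 0 * x t + p * y t + q * z t = κ * (p * l + q * m) := fun t => by
    rw [eq_of_hasDerivAt_zero (h.hasDerivAt_linear 0 p q) (fun t => by
      linear_combination (x t * (p * y t + q * z t)) * ht - x t * y t * hd) t, hy, hz]; ring
  have hw : ∀ t, 0 * x t + r * y t + s * z t = κ * (r * l + s * m) := fun t => by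
    rw [eq_of_hasDerivAt_zero (h.hasDerivAt_linear 0 r s) (fun t => by
      linear_combination (x t * (r * y t + s * z t)) * ht - x t * z t * hd) t, hy, hz]; ring
  set v := κ * (p * l + q * m) with hv'
  set w := κ * (r * l + s * m) with hw'
  have hvw : 0 < v ^ 2 + w ^ 2 := by
    have : v ^ 2 + w ^ 2 = κ ^ 2 * ((p * l + q * m) ^ 2 + (r * l + s * m) ^ 2) := by
      rw [hv', hw']; ring
    rw [this]; positivity
  obtain ⟨t, ht, hlt⟩ := exists_gt_of_le_hasDerivAt (h.hasDerivAt_linear 0 v w)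
    (show 0 < a / 2 * (v ^ 2 + w ^ 2) by positivity) (fun t ht => by
      have h1 := (abs_lt.1 (hb t ht).1).1
      have e1 := hv t
      have e2 := hw t
      have h2 : 0 ≤ (x t - a / 2) * (v ^ 2 + w ^ 2) := mul_nonneg (by linarith) hvw.le
      have : 0 * -(p * y t ^ 2 + (q + r) * y t * z t + s * z t ^ 2) +
          v * (x t * (p * y t + q * z t) - 0 * y t * z t) +
          w * (x t * (r * y t + s * z t) + 0 * y t ^ 2) = x t * (v ^ 2 + w ^ 2) := by
        linear_combination x t * v * e1 + x t * w * e2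
      linarith) (|v| * (a / 2) + |w| * (a / 2))
  have h2 : v * y t ≤ |v| * (a / 2) := (le_abs_self _).trans (by
    rw [abs_mul]; exact mul_le_mul_of_nonneg_left (hb t ht).2.1.le (abs_nonneg _))
  have h3 : w * z t ≤ |w| * (a / 2) := (le_abs_self _).trans (by
    rw [abs_mul]; exact mul_le_mul_of_nonneg_left (hb t ht).2.2.le (abs_nonneg _))
  linarith

/-- The hypothesis on ε dictates the size of the escape neighbourhood in the cases ν ≠ 0: there the
term from ν costs at most half of the linear rate m a. -/
theorem le_sub_mul_of_abs_lt {m n a ε x y : ℝ} (hm : 0 < m) (hε : ε * (2 * (m + |n|)) = m * a)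
    (hx : |x - a| < ε) (hy : |y| < ε) : m * (a / 2) ≤ m * x - n * y := by
  have h1 : n * y ≤ |n| * ε := (le_abs_self _).trans (by
    rw [abs_mul]; exact mul_le_mul_of_nonneg_left hy.le (abs_nonneg _))
  have h2 : m * (a - ε) ≤ m * x := mul_le_mul_of_nonneg_left (by linarith [(abs_lt.1 hx).1]) hm.le
  linarith

/-- Here y' = y (p x - ν z), with rate close to p a > 0. -/
theorem reducedUnstable_of_pos (ha : 0 < a) (hp : 0 < p) : ReducedUnstable p 0 r 0 ν a := by
  set ε := p * a / (2 * (p + |ν|)) with hε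
  have hε0 : 0 < ε := by positivity
  have hε1 : ε * (2 * (p + |ν|)) = p * a := div_mul_cancel₀ _ (by positivity)
  refine ⟨ε, hε0, fun δ hδ => ⟨a, δ / 2, 0, by simpa, ?_, by simpa,
    fun x y z h hx hy hz hb => ?_⟩⟩
  · rw [abs_of_pos (by positivity)]; linarith
  obtain ⟨t, ht, hlt⟩ := exists_gt_of_mul_le_hasDerivAt (fun t => (h.snd t).pow 2)
    (show 0 < p * a by positivity) (fun t ht => by
      have h1 := le_sub_mul_of_abs_lt hp hε1 (hb t ht).1 (hb t ht).2.2
      have h2 := mul_nonneg (sub_nonneg.2 h1) (sq_nonneg (y t))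
      simp only [Pi.pow_apply]
      push_cast
      linarith) (by simp only [Pi.pow_apply]; rw [hy]; positivity) (ε ^ 2)
  have h2 := sq_lt_sq' (abs_lt.1 (hb t ht).2.1).1 (abs_lt.1 (hb t ht).2.1).2
  simp only [Pi.pow_apply] at hlt
  linarith

/-- Chetaev's argument with the function q y z: its derivative dominates a positive multiple of y² +
z² near (a, 0, 0), despite the cubic terms from ν. -/
theorem reducedUnstable_of_saddle (ha : 0 < a) (hqr : 0 < q * r) :
    ReducedUnstable 0 q r 0 ν a := by
  have hq : q ≠ 0 := by rintro rfl; simp at hqr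
  set m := min (q ^ 2) (q * r) with hm
  have hm0 : 0 < m := lt_min (by positivity) hqr
  set ε := m * a / (2 * (m + |q * ν|)) with hε
  have hε0 : 0 < ε := by positivity
  have hε1 : ε * (2 * (m + |q * ν|)) = m * a := div_mul_cancel₀ _ (by positivity)
  have hε2 : ε * (2 * (m + |-(q * ν)|)) = m * a := by rwa [abs_neg]
  refine ⟨ε, hε0, fun δ hδ => ?_⟩
  set κ := δ / (2 * (|q| + 1)) with hκ
  have hκ0 : 0 < κ := by positivity
  have hκ1 : κ * (2 * (|q| + 1)) = δ := div_mul_cancel₀ _ (by positivity)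
  refine ⟨a, κ * q, κ, by simpa, ?_, ?_, fun x y z h hx hy hz hb => ?_⟩
  · rw [abs_mul, abs_of_pos hκ0]; nlinarith [abs_nonneg q]
  · rw [abs_of_pos hκ0]; nlinarith [mul_nonneg hκ0.le (abs_nonneg q)]
  have hq' : 0 < |q| := abs_pos.2 hq
  have hV : ∀ t, HasDerivAt (fun t => q * (y t * z t)) (z t ^ 2 * (q ^ 2 * x t - q * ν * y t) +
      y t ^ 2 * (q * r * x t - -(q * ν) * y t)) t := fun t =>
    (((h.snd t).mul (h.trd t)).const_mul q).congr_deriv (by ring)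
  have hle : ∀ t, q * (y t * z t) ≤ |q| * ((y t ^ 2 + z t ^ 2) / 2) := fun t => by
    refine (le_abs_self _).trans ?_
    rw [abs_mul]
    refine mul_le_mul_of_nonneg_left (abs_le.2 ⟨?_, ?_⟩) hq'.le
    · nlinarith [sq_nonneg (y t + z t)]
    · nlinarith [sq_nonneg (y t - z t)]
  obtain ⟨t, ht, hlt⟩ := exists_gt_of_mul_le_hasDerivAt hV
    (show 0 < m * a / |q| by positivity) (fun t ht => by
      obtain ⟨h1, h2, -⟩ := hb t ht
      have hx0 : 0 < x t := by
        have h3 := le_sub_mul_of_abs_lt hm0 hε1 h1 h2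
        have h4 := le_sub_mul_of_abs_lt hm0 hε2 h1 h2
        nlinarith [mul_pos hm0 ha]
      have h3 := le_sub_mul_of_abs_lt hm0 hε1 h1 h2
      have h4 := le_sub_mul_of_abs_lt hm0 hε2 h1 h2
      have h5 : m * x t ≤ q ^ 2 * x t := mul_le_mul_of_nonneg_right (min_le_left _ _) hx0.le
      have h6 : m * x t ≤ q * r * x t := mul_le_mul_of_nonneg_right (min_le_right _ _) hx0.le
      calc _ ≤ m * a / |q| * (|q| * ((y t ^ 2 + z t ^ 2) / 2)) :=
            mul_le_mul_of_nonneg_left (hle t) (by positivity)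
        _ = z t ^ 2 * (m * (a / 2)) + y t ^ 2 * (m * (a / 2)) := by field_simp; ring
        _ ≤ _ := add_le_add (mul_le_mul_of_nonneg_left (by linarith) (sq_nonneg _))
            (mul_le_mul_of_nonneg_left (by linarith) (sq_nonneg _)))
    (by
      rw [hy, hz, show q * (κ * q * κ) = (q * κ) ^ 2 by ring]
      positivity) (|q| * ε ^ 2)
  have h2 := sq_lt_sq' (abs_lt.1 (hb t ht).2.1).1 (abs_lt.1 (hb t ht).2.1).2
  have h3 := sq_lt_sq' (abs_lt.1 (hb t ht).2.2).1 (abs_lt.1 (hb t ht).2.2).2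
  have h4 : |q| * ((y t ^ 2 + z t ^ 2) / 2) ≤ |q| * ε ^ 2 :=
    mul_le_mul_of_nonneg_left (by linarith) hq'.le
  linarith [hle t]

/-- With V = -ν r y and U = -ν z one has V' = U V and U' = x V - ν² y². Starting from V > 0 and U =
0, both are nondecreasing as long as V ≥ 0. Hence V ≥ V(0), and U' ≥ V(0) a/2 drives U out of any
bounded set. -/
theorem reducedUnstable_of_snd_zero (ha : 0 < a) (hr : r ≠ 0) (hν : ν ≠ 0) :
    ReducedUnstable 0 0 r 0 ν a := by
  have hr' : 0 < |r| := abs_pos.2 hr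
  set ε := |r| * a / (2 * (|r| + |ν|)) with hε
  have hε0 : 0 < ε := by positivity
  have hε1 : ε * (2 * (|r| + |ν|)) = |r| * a := div_mul_cancel₀ _ (by positivity)
  refine ⟨ε, hε0, fun δ hδ => ?_⟩
  set κ := δ / (2 * (|ν * r| + 1)) with hκ
  have hκ0 : 0 < κ := by positivity
  have hκ1 : κ * (2 * (|ν * r| + 1)) = δ := div_mul_cancel₀ _ (by positivity)
  refine ⟨a, -κ * (ν * r), 0, by simpa, ?_, by simpa, fun x y z h hx hy hz hb => ?_⟩
  · rw [abs_mul, abs_neg, abs_of_pos hκ0]; nlinarith [abs_nonneg (ν * r)]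
  have hV : ∀ t, HasDerivAt (fun t => -(ν * r) * y t) (-ν * z t * (-(ν * r) * y t)) t :=
    fun t => ((h.snd t).const_mul _).congr_deriv (by ring)
  have hU : ∀ t, HasDerivAt (fun t => -ν * z t) (-(ν * r) * y t * x t - ν ^ 2 * y t ^ 2) t :=
    fun t => ((h.trd t).const_mul _).congr_deriv (by ring)
  have hV0 : 0 < -(ν * r) * y 0 := by
    rw [hy, show -(ν * r) * (-κ * (ν * r)) = κ * (ν * r) ^ 2 by ring]
    have := mul_ne_zero hν hr
    positivity
  have hU' : ∀ t, 0 ≤ t → 0 ≤ -(ν * r) * y t →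
      -(ν * r) * y t * (a / 2) ≤ -(ν * r) * y t * x t - ν ^ 2 * y t ^ 2 := fun t ht hVt => by
    obtain ⟨h1, h2, -⟩ := hb t ht
    have h3 := le_sub_mul_of_abs_lt (n := |ν|) (y := |y t|) hr' (by rwa [abs_abs]) h1
      (by rwa [abs_abs])
    have h4 : -(ν * r) * y t = |ν| * |r| * |y t| := by
      rw [← abs_of_nonneg hVt, abs_mul, abs_neg, abs_mul]
    have h5 := mul_le_mul_of_nonneg_left h3 (mul_nonneg (abs_nonneg ν) (abs_nonneg (y t)))
    rw [h4, ← sq_abs ν, ← sq_abs (y t)]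
    linarith
  have hU0 : ∀ t, 0 ≤ t → (∀ u ∈ Icc 0 t, 0 ≤ -(ν * r) * y u) → 0 ≤ -ν * z t :=
    fun t ht hu => by
      have := le_of_hasDerivAt_nonneg hU ht fun u hut =>
        (mul_nonneg (hu u hut) (by positivity)).trans (hU' u hut.1 (hu u hut))
      simpa [hz] using this
  have hVmono : ∀ t, 0 ≤ t → (∀ u ∈ Icc 0 t, 0 ≤ -(ν * r) * y u) →
      -(ν * r) * y 0 ≤ -(ν * r) * y t := fun t ht hu =>
    le_of_hasDerivAt_nonneg hV ht fun u hut => mul_nonneg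
      (hU0 u hut.1 fun v hv => hu v ⟨hv.1, hv.2.trans hut.2⟩) (hu u hut)
  have hVpos := pos_of_continuous_of_ne_zero (g := fun t => -(ν * r) * y t)
    (continuous_const.mul h.continuous_snd) hV0
    fun t ht hu => (hV0.trans_le (hVmono t ht hu)).ne'
  obtain ⟨t, ht, hlt⟩ := exists_gt_of_le_hasDerivAt hU
    (show 0 < -(ν * r) * y 0 * (a / 2) by positivity) (fun t ht =>
      (mul_le_mul_of_nonneg_right (hVmono t ht fun u hu => (hVpos u hu.1).le)
        (by positivity)).trans (hU' t ht (hVpos t ht).le)) (|ν| * ε)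
  have h2 : -ν * z t ≤ |ν| * ε := (le_abs_self _).trans (by
    rw [abs_mul, abs_neg]; exact mul_le_mul_of_nonneg_left (hb t ht).2.2.le (abs_nonneg _))
  linarith

/-- Since z' = ν y², the function ν z never decreases; once positive, it forces ν q y to grow at
least linearly. -/
theorem reducedUnstable_of_trd_zero (ha : 0 < a) (hq : q ≠ 0) (hν : ν ≠ 0) :
    ReducedUnstable 0 q 0 0 ν a := by
  have hq' : 0 < q ^ 2 := by positivity
  set ε := q ^ 2 * a / (2 * (q ^ 2 + |ν * q|)) with hε
  have hε0 : 0 < ε := by positivity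
  have hε1 : ε * (2 * (q ^ 2 + |ν * q|)) = q ^ 2 * a := div_mul_cancel₀ _ (by positivity)
  refine ⟨ε, hε0, fun δ hδ => ?_⟩
  set κ := δ / (2 * (|ν| + 1)) with hκ
  have hκ0 : 0 < κ := by positivity
  have hκ1 : κ * (2 * (|ν| + 1)) = δ := div_mul_cancel₀ _ (by positivity)
  refine ⟨a, 0, κ * ν, by simpa, by simpa, ?_, fun x y z h hx hy hz hb => ?_⟩
  · rw [abs_mul, abs_of_pos hκ0]; nlinarith [abs_nonneg ν]
  have hU : ∀ t, HasDerivAt (fun t => ν * z t) ((ν * y t) ^ 2) t :=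
    fun t => ((h.trd t).const_mul _).congr_deriv (by ring)
  have hU0 : 0 < ν * z 0 := by
    rw [hz, show ν * (κ * ν) = κ * ν ^ 2 by ring]
    positivity
  have hUmono : ∀ t, 0 ≤ t → ν * z 0 ≤ ν * z t := fun t ht =>
    le_of_hasDerivAt_nonneg hU ht fun u _ => sq_nonneg _
  have hT : ∀ t, HasDerivAt (fun t => ν * q * y t)
      (ν * z t * (q ^ 2 * x t - ν * q * y t)) t := fun t =>
    ((h.snd t).const_mul _).congr_deriv (by ring)
  obtain ⟨t, ht, hlt⟩ := exists_gt_of_le_hasDerivAt hT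
    (show 0 < ν * z 0 * (q ^ 2 * (a / 2)) by positivity) (fun t ht =>
      mul_le_mul (hUmono t ht) (le_sub_mul_of_abs_lt hq' hε1 (hb t ht).1 (hb t ht).2.1)
        (by positivity) (hU0.le.trans (hUmono t ht))) (|ν * q| * ε)
  have h2 : ν * q * y t ≤ |ν * q| * ε := (le_abs_self _).trans (by
    rw [abs_mul]; exact mul_le_mul_of_nonneg_left (hb t ht).2.1.le (abs_nonneg _))
  linarith

end Unstable

/-! ### Stability by Lyapunov functions and first integrals -/

section Stable

variable {p q r s ν a : ℝ}

theorem reducedStable_of_linear_zero : ReducedStable 0 0 0 0 ν a := fun ε hε => by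
  refine ⟨ε / 2, by positivity, fun x y z h hx hy hz t ht => ?_⟩
  have h1 : x t = x 0 := eq_of_hasDerivAt_zero h.fst (fun t => by ring) t
  have h2 := h.normSq_eq t
  rw [h1] at h2 ⊢
  have h3 := sq_lt_sq' (abs_lt.1 hy).1 (abs_lt.1 hy).2
  have h4 := sq_lt_sq' (abs_lt.1 hz).1 (abs_lt.1 hz).2
  refine ⟨by linarith, abs_lt_of_sq_lt_sq ?_ hε.le, abs_lt_of_sq_lt_sq ?_ hε.le⟩
  · nlinarith [sq_nonneg (z t)]
  · nlinarith [sq_nonneg (y t)]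

/-- The form W(w) = |adj(M) w|² + |M w|² + 2d|w|² has derivative 2 x tr(M) (|M w|² + d|w|²), which
is nonpositive for x ≥ 0. As M + adj(M) = tr M, it is at least k|w|² with k = 2d + (tr M)²/2, hence
definite even when d = 0. Conservation of the norm then controls x. -/
theorem reducedStable_of_det_nonneg (ha : 0 < a) (hd : 0 ≤ p * s - q * r) (ht : p + s ≤ 0)
    (hs : 0 < p * s - q * r ∨ p + s < 0) : ReducedStable p q r s 0 a := by
  set d := p * s - q * r with hd'
  set k := 2 * d + (p + s) ^ 2 / 2 with hk
  have hk0 : 0 < k := by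
    rcases hs with h | h
    · positivity
    · have : p + s ≠ 0 := h.ne
      positivity
  intro ε hε
  let W : ℝ → ℝ → ℝ := fun y z => (s * y + -q * z) ^ 2 + (-r * y + p * z) ^ 2 +
    ((p * y + q * z) ^ 2 + (r * y + s * z) ^ 2) + 2 * d * (y ^ 2 + z ^ 2)
  have hW0 : ∀ y z, k * (y ^ 2 + z ^ 2) ≤ W y z := fun y z => by
    simp only [W, hk]
    nlinarith [sq_nonneg (s * y + -q * z - (p * y + q * z)),
      sq_nonneg (-r * y + p * z - (r * y + s * z))]
  -- The three bounds serve, in order, |y|, |z| < ε, then |x - a| < ε, and finally x ≠ 0 in the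
  -- continuous induction.
  set η := min (ε ^ 2) (min (a * ε) (a ^ 2)) with hη
  have hη0 : 0 < η := by positivity
  obtain ⟨δ, hδ, hΦ⟩ := exists_delta_of_continuous (a := a)
    (Φ := fun x y z => |x ^ 2 + y ^ 2 + z ^ 2 - a ^ 2| + W y z / k)
    (by simp only [W]; fun_prop) (by simp [W]) hη0
  refine ⟨min δ a, by positivity, fun x y z h hx hy hz => ?_⟩
  have hx0 : 0 < x 0 := by linarith [(abs_lt.1 (hx.trans_le (min_le_right _ _))).1]
  have hΦ0 := hΦ (x 0) (y 0) (z 0) (hx.trans_le (min_le_left _ _))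
    (hy.trans_le (min_le_left _ _)) (hz.trans_le (min_le_left _ _))
  replace hΦ0 := (le_abs_self _).trans_lt hΦ0
  have hV : ∀ t, HasDerivAt (fun t => W (y t) (z t))
      (2 * x t * (p + s) * ((p * y t + q * z t) ^ 2 + (r * y t + s * z t) ^ 2 +
        d * (y t ^ 2 + z t ^ 2))) t := fun t =>
    ((((((h.snd t).const_mul s).add ((h.trd t).const_mul (-q))).pow 2).add
      ((((h.snd t).const_mul (-r)).add ((h.trd t).const_mul p)).pow 2)).add
      (((((h.snd t).const_mul p).add ((h.trd t).const_mul q)).pow 2).add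
      ((((h.snd t).const_mul r).add ((h.trd t).const_mul s)).pow 2)) |>.add
      ((((h.snd t).pow 2).add ((h.trd t).pow 2)).const_mul (2 * d))).congr_deriv (by
        simp only [Pi.add_apply]
        push_cast
        rw [hd']; ring)
  have hw : ∀ t, 0 ≤ t → (∀ u ∈ Icc 0 t, 0 ≤ x u) →
      y t ^ 2 + z t ^ 2 ≤ W (y 0) (z 0) / k := fun t ht' hu => by
    rw [le_div_iff₀ hk0]
    have h1 := le_of_hasDerivAt_nonpos hV ht' fun u hut => by
      have h2 : 0 ≤ x u * -(p + s) := mul_nonneg (hu u hut) (by linarith)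
      have h3 : 0 ≤ (p * y u + q * z u) ^ 2 + (r * y u + s * z u) ^ 2 +
        d * (y u ^ 2 + z u ^ 2) := by positivity
      nlinarith [mul_nonneg h2 h3]
    linarith [hW0 (y t) (z t)]
  have hnorm : ∀ t, y t ^ 2 + z t ^ 2 ≤ W (y 0) (z 0) / k → |x t ^ 2 - a ^ 2| < η :=
    fun t hle => by
      have h1 := h.normSq_eq t
      rw [show x t ^ 2 - a ^ 2 = (x 0 ^ 2 + y 0 ^ 2 + z 0 ^ 2 - a ^ 2) - (y t ^ 2 + z t ^ 2) by
        linarith]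
      refine (abs_sub _ _).trans_lt ?_
      rw [abs_of_nonneg (show 0 ≤ y t ^ 2 + z t ^ 2 by positivity)]
      linarith
  have hpos := pos_of_continuous_of_ne_zero h.continuous_fst hx0 fun t ht' hu h0 => by
    have h1 := (abs_lt.1 (hnorm t (hw t ht' hu))).1
    have h2 : η ≤ a ^ 2 := (min_le_right _ _).trans (min_le_right _ _)
    rw [h0] at h1
    linarith
  intro t ht'
  have h1 := hw t ht' fun u hu => (hpos u hu.1).le
  have h2 : y t ^ 2 + z t ^ 2 < ε ^ 2 := by
    have : η ≤ ε ^ 2 := min_le_left _ _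
    linarith [abs_nonneg (x 0 ^ 2 + y 0 ^ 2 + z 0 ^ 2 - a ^ 2)]
  refine ⟨(abs_sub_le_of_sq ha (hpos t ht').le).trans_lt ?_, abs_lt_of_sq_lt_sq ?_ hε.le,
    abs_lt_of_sq_lt_sq ?_ hε.le⟩
  · rw [div_lt_iff₀ ha]
    have : η ≤ a * ε := (min_le_right _ _).trans (min_le_left _ _)
    linarith [hnorm t h1]
  · nlinarith [sq_nonneg (z t)]
  · nlinarith [sq_nonneg (y t)]

/-- Put g = ν z - p x, so that y' = -g y and y² does not increase while g ≥ 0. The first integral ν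
x - r y + p z then keeps c = ν x + p z near ν a. Since c² + g² = (ν² + p²)(x² + z²), conservation of
the norm keeps g near g₀ = -p a > 0. Finally c and g determine x and z. -/
theorem reducedStable_of_neg (ha : 0 < a) (hp : p < 0) : ReducedStable p 0 r 0 ν a := by
  intro ε hε
  set D := ν ^ 2 + p ^ 2 with hD
  have hD0 : 0 < D := add_pos_of_nonneg_of_pos (sq_nonneg _) (by nlinarith)
  set g₀ := -p * a with hg₀
  have hg₀' : 0 < g₀ := mul_pos (by linarith) ha
  -- `Φ₁` bounds the deviation of c from ν a and `Φ₂` that of g² from g₀², both in terms of the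
  -- initial values, so a single continuity argument yields δ.
  let Φ₁ : ℝ → ℝ → ℝ → ℝ := fun x y z => |ν * x + p * z - ν * a| + 2 * |r| * |y|
  let Φ₂ : ℝ → ℝ → ℝ → ℝ := fun x y z => D * |x ^ 2 + y ^ 2 + z ^ 2 - a ^ 2| + D * y ^ 2 +
    Φ₁ x y z * (Φ₁ x y z + 2 * |ν * a|)
  obtain ⟨δ, hδ, hΦ⟩ := exists_delta_of_continuous (a := a)
    (Φ := fun x y z => |y| + (|ν| + |p|) * (Φ₁ x y z + Φ₂ x y z / g₀) / D + Φ₂ x y z +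
      |ν * z - p * x - g₀|)
    (by simp only [Φ₁, Φ₂]; fun_prop) (by simp [Φ₁, Φ₂, hg₀])
    (show 0 < min ε (min (g₀ ^ 2) g₀) by positivity)
  refine ⟨min δ a, by positivity, fun x y z h hx hy hz => ?_⟩
  have hΦ0 := hΦ (x 0) (y 0) (z 0) (hx.trans_le (min_le_left _ _))
    (hy.trans_le (min_le_left _ _)) (hz.trans_le (min_le_left _ _))
  replace hΦ0 := (le_abs_self _).trans_lt hΦ0
  have hΦ₁ : 0 ≤ Φ₁ (x 0) (y 0) (z 0) := by simp only [Φ₁]; positivity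
  have hΦ₂ : 0 ≤ Φ₂ (x 0) (y 0) (z 0) := by simp only [Φ₂]; positivity
  set A := Φ₁ (x 0) (y 0) (z 0) with hA
  set B := Φ₂ (x 0) (y 0) (z 0) with hB
  have hsum : 0 ≤ (|ν| + |p|) * (A + B / g₀) / D := by positivity
  have hBg : B < g₀ ^ 2 := by
    linarith [(min_le_right ε (min (g₀ ^ 2) g₀)).trans (min_le_left _ _), abs_nonneg (y 0),
      abs_nonneg (ν * z 0 - p * x 0 - g₀)]
  have hlt : |y 0| + (|ν| + |p|) * (A + B / g₀) / D < ε := by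
    linarith [min_le_left ε (min (g₀ ^ 2) g₀), abs_nonneg (ν * z 0 - p * x 0 - g₀)]
  have hg0 : 0 < ν * z 0 - p * x 0 := by
    have h1 : |ν * z 0 - p * x 0 - g₀| < g₀ := by
      linarith [(min_le_right ε (min (g₀ ^ 2) g₀)).trans (min_le_right _ _), abs_nonneg (y 0)]
    linarith [(abs_lt.1 h1).1]
  have hY : ∀ t, HasDerivAt (fun t => y t ^ 2) (-(2 * y t ^ 2 * (ν * z t - p * x t))) t :=
    fun t => ((h.snd t).pow 2).congr_deriv (by push_cast; ring)
  have hy' : ∀ t, 0 ≤ t → (∀ u ∈ Icc 0 t, 0 ≤ ν * z u - p * x u) → y t ^ 2 ≤ y 0 ^ 2 :=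
    fun t ht hu => le_of_hasDerivAt_nonpos hY ht fun u hut =>
      neg_nonpos.2 (mul_nonneg (by positivity) (hu u hut))
  have hC : ∀ t, ν * x t + -r * y t + p * z t = ν * x 0 + -r * y 0 + p * z 0 :=
    eq_of_hasDerivAt_zero (h.hasDerivAt_linear ν (-r) p) fun t => by ring
  have hc : ∀ t, y t ^ 2 ≤ y 0 ^ 2 → |ν * x t + p * z t - ν * a| ≤ A := fun t hyt => by
    have h1 : ν * x t + p * z t - ν * a =
        (ν * x 0 + p * z 0 - ν * a) + (r * y t - r * y 0) := by linarith [hC t]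
    have h2 : |r * y t - r * y 0| ≤ 2 * |r| * |y 0| := by
      refine (abs_sub _ _).trans ?_
      rw [abs_mul, abs_mul]
      have := mul_le_mul_of_nonneg_left (sq_le_sq.1 hyt) (abs_nonneg r)
      linarith
    rw [h1, hA]
    exact (abs_add_le _ _).trans (by simp only [Φ₁]; linarith)
  have hg : ∀ t, y t ^ 2 ≤ y 0 ^ 2 → |(ν * z t - p * x t) ^ 2 - g₀ ^ 2| ≤ B := fun t hyt => by
    have h1 := hc t hyt
    set c := ν * x t + p * z t with hc'
    have h2 : (ν * z t - p * x t) ^ 2 - g₀ ^ 2 = D * (x 0 ^ 2 + y 0 ^ 2 + z 0 ^ 2 - a ^ 2) -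
        D * y t ^ 2 - (c - ν * a) * ((c - ν * a) + 2 * (ν * a)) := by
      rw [← h.normSq_eq t, hc', hD, hg₀]; ring
    rw [h2, hB]
    refine (abs_sub _ _).trans (add_le_add ((abs_sub _ _).trans (add_le_add ?_ ?_)) ?_)
    · rw [abs_mul, abs_of_pos hD0]
    · rw [abs_of_nonneg (by positivity)]
      exact mul_le_mul_of_nonneg_left hyt hD0.le
    · rw [abs_mul]
      refine mul_le_mul h1 ((abs_add_le _ _).trans ?_) (abs_nonneg _) hΦ₁
      rw [abs_mul 2, abs_two]
      linarith
  have hpos := pos_of_continuous_of_ne_zero (g := fun t => ν * z t - p * x t)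
    ((continuous_const.mul h.continuous_trd).sub (continuous_const.mul h.continuous_fst)) hg0
    fun t ht hu h0 => by
    have h1 := (abs_le.1 (hg t (hy' t ht hu))).1
    rw [h0] at h1
    linarith
  intro t ht
  have hyt := hy' t ht fun u hu => (hpos u hu.1).le
  have h1 := hc t hyt
  have h2 : |ν * z t - p * x t - g₀| ≤ B / g₀ :=
    (abs_sub_le_of_sq hg₀' (hpos t ht).le).trans
      (div_le_div_of_nonneg_right (hg t hyt) hg₀'.le)
  have h3 : ∀ m n : ℝ, |m| ≤ |ν| + |p| → |n| ≤ |ν| + |p| →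
      |(m * (ν * x t + p * z t - ν * a) + n * (ν * z t - p * x t - g₀)) / D| < ε :=
    fun m n hm hn => by
      refine lt_of_le_of_lt ?_ (lt_of_le_of_lt (le_add_of_nonneg_left (abs_nonneg (y 0))) hlt)
      rw [abs_div, abs_of_pos hD0]
      refine div_le_div_of_nonneg_right ((abs_add_le _ _).trans ?_) hD0.le
      rw [abs_mul, abs_mul, mul_add]
      exact add_le_add (mul_le_mul hm h1 (abs_nonneg _) (by positivity))
        (mul_le_mul hn h2 (abs_nonneg _) (by positivity))
  refine ⟨?_, by linarith [sq_le_sq.1 hyt], ?_⟩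
  -- Inversion of the similarity (x, z) ↦ (c, g): D x = ν c - p g, and below D z = p c + ν g.
  · convert h3 ν (-p) (by simp) (by simp) using 2
    rw [eq_div_iff hD0.ne', hD, hg₀]; ring
  · convert h3 p ν (by simp) (by simp) using 2
    rw [eq_div_iff hD0.ne', hD, hg₀]; ring

end Stable

/-- A function with vanishing first and positive second derivative at `0` exceeds its value at `0`
at both ends of arbitrarily small symmetric intervals. -/
theorem exists_lt_of_second_deriv_pos {h k : ℝ → ℝ} (hh : ∀ u, HasDerivAt h (k u) u) {c : ℝ}
    (hk : HasDerivAt k c 0) (hk0 : k 0 = 0) (hc : 0 < c) {η : ℝ} (hη : 0 < η) :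
    ∃ u, 0 < u ∧ u < η ∧ h 0 < h u ∧ h 0 < h (-u) := by
  have hs := eventually_nhdsWithin_sign_eq_of_deriv_pos (f := k) (x₀ := 0)
    (by rw [hk.deriv]; exact hc) hk0
  obtain ⟨ρ, hρ, hs⟩ := Metric.eventually_nhds_iff.1 hs
  have hu : 0 < min ρ η / 2 := by positivity
  have hρu : min ρ η / 2 < ρ := by linarith [min_le_left ρ η]
  refine ⟨min ρ η / 2, hu, by linarith [min_le_right ρ η], ?_, ?_⟩
  · refine strictMonoOn_of_deriv_pos (convex_Icc 0 (min ρ η / 2))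
      (fun v _ => (hh v).continuousAt.continuousWithinAt) (fun v hv => ?_)
      (left_mem_Icc.2 hu.le) (right_mem_Icc.2 hu.le) hu
    rw [interior_Icc] at hv
    rw [(hh v).deriv, ← sign_eq_one_iff, hs (by
      rw [Real.dist_eq, sub_zero, abs_of_pos hv.1]; linarith [hv.2]), sign_eq_one_iff, sub_zero]
    exact hv.1
  · refine strictAntiOn_of_deriv_neg (convex_Icc (-(min ρ η / 2)) 0)
      (fun v _ => (hh v).continuousAt.continuousWithinAt) (fun v hv => ?_)
      (left_mem_Icc.2 (by linarith)) (right_mem_Icc.2 (by linarith)) (by linarith)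
    rw [interior_Icc] at hv
    rw [(hh v).deriv, ← sign_eq_neg_one_iff, hs (by
      rw [Real.dist_eq, sub_zero, abs_of_neg hv.2]; linarith [hv.1]), sign_eq_neg_one_iff, sub_zero]
    exact hv.2

/-! ### The center: time-changed linear flow -/

section Exp

variable {E : Type*} [NormedAddCommGroup E] [NormedSpace ℝ E] [CompleteSpace E]

open NormedSpace in
/-- A time change of the flow of a linear vector field. -/
theorem eq_exp_smul_apply_of_hasDerivAt (B : E →L[ℝ] E) {w : ℝ → E} {σ z : ℝ → ℝ}
    (hw : ∀ t, HasDerivAt w (z t • B (w t)) t) (hσ : ∀ t, HasDerivAt σ (z t) t) (h0 : σ 0 = 0)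
    (t : ℝ) : w t = exp (σ t • B) (w 0) := by
  have hexp : ∀ t, HasDerivAt (fun t => exp ((-σ t) • B)) ((-z t) • (exp ((-σ t) • B) * B)) t :=
    fun t =>
      HasDerivAt.scomp (g₁ := fun u => exp (u • B)) (h := fun t => -σ t) t
        (hasDerivAt_exp_smul_const B (-σ t)) (hσ t).neg
  have hu : ∀ t, HasDerivAt (fun t => exp ((-σ t) • B) (w t)) 0 t := fun t => by
    refine ((hexp t).clm_apply (hw t)).congr_deriv ?_
    simp
  have hconst : exp ((-σ t) • B) (w t) = w 0 := by
    rw [is_const_of_deriv_eq_zero (fun t => (hu t).differentiableAt) (fun t => (hu t).deriv) t 0]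
    simp [h0]
  have hmul : exp (σ t • B) * exp ((-σ t) • B) = 1 := by
    let _ : NormedAlgebra ℚ (E →L[ℝ] E) := NormedAlgebra.restrictScalars ℚ ℝ _
    rw [← exp_add_of_commute (((Commute.refl B).smul_left _).smul_right _), ← add_smul]
    simp
  rw [← hconst, ← mul_apply_eq_comp, hmul, one_apply_eq_self]

end Exp

theorem exists_delta_of_eventually {P : ℝ × ℝ × ℝ → Prop} {a : ℝ}
    (h : ∀ᶠ v in 𝓝 ((a, 0, 0) : ℝ × ℝ × ℝ), P v) :
    ∃ δ > 0, ∀ x y z : ℝ, |x - a| < δ → |y| < δ → |z| < δ → P (x, y, z) := by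
  obtain ⟨δ, hδ, h⟩ := Metric.eventually_nhds_iff.1 h
  exact ⟨δ, hδ, fun x y z hx hy hz => h (by simp [Prod.dist_eq, Real.dist_eq, hx, hy, hz])⟩

-- When p = s = 0, both x' and y' are z times a linear function of (x, y), so (x, y) = exp(σB)(x(0),
-- y(0)) with σ' = z. Along the flow line of (a, 0), x² + y² has second derivative -2qra² > 0 at σ =
-- 0, so it exceeds a² at σ = ±σ₀. For nearby data it still exceeds the conserved x² + y² + z²
-- there, so σ never reaches ±σ₀.
open NormedSpace in
theorem reducedStable_of_center {q r ν a : ℝ} (ha : 0 < a) (hqr : q * r < 0) :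
    ReducedStable 0 q r 0 ν a := by
  intro ε hε
  let B : (ℝ × ℝ) →L[ℝ] (ℝ × ℝ) := (-(q + r) • ContinuousLinearMap.snd ℝ ℝ ℝ).prod
    (q • ContinuousLinearMap.fst ℝ ℝ ℝ - ν • ContinuousLinearMap.snd ℝ ℝ ℝ)
  let P : ℝ → ℝ × ℝ → ℝ × ℝ := fun u w => exp (u • B) w
  have hexp : Continuous fun u : ℝ => exp (u • B) :=
    continuous_iff_continuousAt.2 fun u => (hasDerivAt_exp_smul_const' B u).continuousAt
  have hP : Continuous fun v : ℝ × ℝ × ℝ => P v.1 v.2 :=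
    (hexp.comp continuous_fst).clm_apply continuous_snd
  have hP0 : ∀ w, P 0 w = w := fun w => by simp [P]
  have hPd : ∀ w u, HasDerivAt (fun u => P u w) (B (P u w)) u := fun w u =>
    ((hasDerivAt_exp_smul_const' B u).clm_apply (hasDerivAt_const u w)).congr_deriv (by simp [P])
  have hX : ∀ w u, HasDerivAt (fun u => (P u w).1) (-(q + r) * (P u w).2) u := fun w u =>
    ((hasFDerivAt_fst (𝕜 := ℝ)).comp_hasDerivAt u (hPd w u)).congr_deriv (by simp [B])
  have hY : ∀ w u, HasDerivAt (fun u => (P u w).2) (q * (P u w).1 - ν * (P u w).2) u := fun w u =>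
    ((hasFDerivAt_snd (𝕜 := ℝ)).comp_hasDerivAt u (hPd w u)).congr_deriv (by simp [B])
  -- the squared norm has a strict minimum along the linear flow line through `(a, 0)`
  obtain ⟨η, hη, hnear⟩ := exists_delta_of_continuous (a := 0)
    (Φ := fun u x y => |(P u (x + a, y)).1 - a| + |(P u (x + a, y)).2| +
      |(P u (x + a, y)).1 ^ 2 + (P u (x + a, y)).2 ^ 2 - a ^ 2|) (by
      have : Continuous fun v : ℝ × ℝ × ℝ => P v.1 (v.2.1 + a, v.2.2) :=
        hP.comp (by fun_prop : Continuous fun v : ℝ × ℝ × ℝ => (v.1, v.2.1 + a, v.2.2))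
      fun_prop) (by simp [hP0]) (show 0 < min ε (ε ^ 2 / 2) by positivity)
  obtain ⟨σ₀, hσ₀, hση, hplus, hminus⟩ := exists_lt_of_second_deriv_pos
    (h := fun u => (P u (a, 0)).1 ^ 2 + (P u (a, 0)).2 ^ 2)
    (k := fun u => -2 * (P u (a, 0)).2 * (r * (P u (a, 0)).1 + ν * (P u (a, 0)).2))
    (c := -2 * (q * r) * a ^ 2)
    (fun u => (((hX _ u).pow 2).add ((hY _ u).pow 2)).congr_deriv (by push_cast; ring))
    ((((hY (a, 0) 0).const_mul (-2)).mul
      (((hX (a, 0) 0).const_mul r).add ((hY (a, 0) 0).const_mul ν))).congr_deriv (by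
        simp [hP0]; ring))
    (by simp [hP0]) (by nlinarith [mul_pos (neg_pos.2 hqr) (pow_pos ha 2)]) hη
  simp only [hP0] at hplus hminus
  have hend : ∀ u, a ^ 2 + 0 ^ 2 < (P u (a, 0)).1 ^ 2 + (P u (a, 0)).2 ^ 2 →
      ∀ᶠ v in 𝓝 ((a, 0, 0) : ℝ × ℝ × ℝ), v.1 ^ 2 + v.2.1 ^ 2 + v.2.2 ^ 2 <
        (P u (v.1, v.2.1)).1 ^ 2 + (P u (v.1, v.2.1)).2 ^ 2 := fun u hu => by
    have : Continuous fun v : ℝ × ℝ × ℝ => P u (v.1, v.2.1) :=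
      hP.comp (by fun_prop : Continuous fun v : ℝ × ℝ × ℝ => (u, v.1, v.2.1))
    exact ContinuousAt.eventually_lt (by fun_prop) (by fun_prop) (by simpa using hu)
  have hE : ∀ᶠ v in 𝓝 ((a, 0, 0) : ℝ × ℝ × ℝ),
      |v.1 ^ 2 + v.2.1 ^ 2 + v.2.2 ^ 2 - a ^ 2| < ε ^ 2 / 2 :=
    ContinuousAt.eventually_lt (by fun_prop) (by fun_prop) (by simpa using by positivity)
  obtain ⟨δ, hδ, hinit⟩ := exists_delta_of_eventually (((hend _ hplus).and (hend _ hminus)).and hE)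
  refine ⟨min δ η, by positivity, fun x y z h hx hy hz => ?_⟩
  obtain ⟨⟨h1, h2⟩, h3⟩ := hinit (x 0) (y 0) (z 0) (hx.trans_le (min_le_left _ _))
    (hy.trans_le (min_le_left _ _)) (hz.trans_le (min_le_left _ _))
  simp only at h1 h2 h3
  let σ : ℝ → ℝ := fun t => ∫ u in (0 : ℝ)..t, z u
  have hσ : ∀ t, HasDerivAt σ (z t) t := fun t =>
    intervalIntegral.integral_hasDerivAt_right (h.continuous_trd.intervalIntegrable _ _)
      (h.continuous_trd.stronglyMeasurableAtFilter _ _) h.continuous_trd.continuousAt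
  have hσ0 : σ 0 = 0 := by simp [σ]
  have hw : ∀ t, (x t, y t) = P (σ t) (x 0, y 0) :=
    eq_exp_smul_apply_of_hasDerivAt B (w := fun t => (x t, y t)) (fun t =>
      ((h.fst t).prodMk (h.snd t)).congr_deriv (by
        ext
        · simp [B]; ring
        · simp [B]; ring)) hσ hσ0
  have hne : ∀ t u, x 0 ^ 2 + y 0 ^ 2 + z 0 ^ 2 <
      (P u (x 0, y 0)).1 ^ 2 + (P u (x 0, y 0)).2 ^ 2 → σ t ≠ u := fun t u hu hσt => by
    rw [← hσt, ← hw t, ← h.normSq_eq t] at hu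
    simp only at hu
    linarith [sq_nonneg (z t)]
  have hpos := pos_of_continuous_of_ne_zero (g := fun t => σ₀ ^ 2 - σ t ^ 2)
    (continuous_const.sub ((continuous_iff_continuousAt.2 fun t => (hσ t).continuousAt).pow 2))
    (by simp [hσ0, hσ₀]) fun t _ _ hzero => by
      rcases sq_eq_sq_iff_eq_or_eq_neg.1 (sub_eq_zero.1 hzero).symm with heq | heq
      · exact hne t _ h1 heq
      · exact hne t _ h2 heq
  intro t ht
  have hσt : |σ t| < η := (abs_lt_of_sq_lt_sq (sub_pos.1 (hpos t ht)) hσ₀.le).trans hση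
  have h4 := hnear (σ t) (x 0 - a) (y 0) (by simpa using hσt) (hx.trans_le (min_le_right _ _))
    (hy.trans_le (min_le_right _ _))
  replace h4 := (le_abs_self _).trans_lt h4
  simp only [sub_add_cancel] at h4
  rw [← hw t] at h4
  simp only at h4
  have h5 := min_le_left ε (ε ^ 2 / 2)
  have h6 := min_le_right ε (ε ^ 2 / 2)
  have h7 := abs_nonneg (x t - a)
  have h8 := abs_nonneg (y t)
  have h9 := abs_nonneg (x t ^ 2 + y t ^ 2 - a ^ 2)
  refine ⟨by linarith, by linarith, abs_lt_of_sq_lt_sq ?_ hε.le⟩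
  have h10 := (abs_lt.1 (show |x t ^ 2 + y t ^ 2 - a ^ 2| < ε ^ 2 / 2 by linarith)).1
  have h11 := (abs_lt.1 h3).2
  linarith [h.normSq_eq t]


/-- For ν = 0, if the criterion fails, then trace and determinant are both positive, or M is nonzero
nilpotent, or M has a positive real eigenvalue. For ν ≠ 0 the Jacobi constraint reduces the
discussion to the signs of p and qr. -/
theorem reducedStable_or_reducedUnstable {p q r s ν a : ℝ} (ha : 0 < a)
    (hJ : ν = 0 ∨ s = 0 ∧ p * q = 0) :
    ((p = 0 ∧ q = 0 ∧ r = 0 ∧ s = 0) ∨ (0 ≤ p * s - q * r ∧ p + s ≤ 0 ∧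
      (0 < p * s - q * r ∨ p + s < 0)) → ReducedStable p q r s ν a) ∧
    (¬ ((p = 0 ∧ q = 0 ∧ r = 0 ∧ s = 0) ∨ (0 ≤ p * s - q * r ∧ p + s ≤ 0 ∧
      (0 < p * s - q * r ∨ p + s < 0))) → ReducedUnstable p q r s ν a) := by
  by_cases hν : ν = 0
  · subst hν
    refine ⟨?_, fun hn => ?_⟩
    · rintro (⟨rfl, rfl, rfl, rfl⟩ | ⟨hd, ht, hs⟩)
      · exact reducedStable_of_linear_zero
      · exact reducedStable_of_det_nonneg ha hd ht hs
    · push Not at hn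
      obtain ⟨hM, hn⟩ := hn
      by_cases h1 : 0 < p + s ∧ 0 < p * s - q * r
      · exact reducedUnstable_of_trace_pos_of_det_pos ha h1.1 h1.2
      by_cases h2 : p * s - q * r = 0 ∧ p + s = 0
      · exact reducedUnstable_of_nilpotent ha h2.2 h2.1 fun h => hM h.1 h.2.1 h.2.2.1 h.2.2.2
      have hd : p * s - q * r ≤ 0 := by
        by_contra! hd
        have h3 : p + s ≤ 0 := by
          by_contra! h3
          exact h1 ⟨h3, hd⟩
        linarith [(hn hd.le h3).1]
      have hlt : p * s - q * r < 0 ∨ 0 < p + s := by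
        rcases hd.lt_or_eq with h | h
        · exact Or.inl h
        · refine Or.inr ?_
          by_contra! h3
          exact h2 ⟨h, le_antisymm h3 (hn h.ge h3).2⟩
      -- The larger root of the characteristic polynomial; it is real because det M ≤ 0.
      set μ := (p + s + √((p + s) ^ 2 - 4 * (p * s - q * r))) / 2 with hμ
      have hD : 0 ≤ (p + s) ^ 2 - 4 * (p * s - q * r) := by nlinarith [sq_nonneg (p + s)]
      have hroot : (μ - p) * (μ - s) = q * r := by
        rw [hμ]; nlinarith [Real.sq_sqrt hD]
      have hμ0 : 0 < μ := by
        have hge : |p + s| ≤ √((p + s) ^ 2 - 4 * (p * s - q * r)) :=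
          Real.abs_le_sqrt (by linarith)
        rcases hlt with h | h
        · have hgt : |p + s| < √((p + s) ^ 2 - 4 * (p * s - q * r)) :=
            Real.lt_sqrt_of_sq_lt (by rw [sq_abs]; linarith)
          linarith [neg_abs_le (p + s)]
        · linarith [le_abs_self (p + s)]
      by_cases hl : 0 < r ^ 2 + (μ - p) ^ 2
      · exact reducedUnstable_of_eigenvalue ha (l := r) (m := μ - p) (μ := μ) (by ring)
          (by linarith) hμ0 hl
      · have hr : r = 0 := by nlinarith [sq_nonneg r, sq_nonneg (μ - p)]
        have hp : μ - p = 0 := by nlinarith [sq_nonneg r, sq_nonneg (μ - p)]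
        -- The left eigenvector (r, μ - p) vanished, so the other one is used. Were μ = s as well,
        -- det M = μ² would be positive.
        refine reducedUnstable_of_eigenvalue ha (l := μ - s) (m := q) (μ := μ) (by linarith)
          (by ring) hμ0 ?_
        have : μ - s ≠ 0 := fun hs => by
          have : p * s - q * r = μ ^ 2 := by
            rw [hr, show p = μ by linarith, show s = μ by linarith]; ring
          nlinarith
        positivity
  · obtain ⟨rfl, hpq⟩ := hJ.resolve_left hν
    simp only [mul_zero, zero_sub, add_zero, and_true]
    rcases lt_trichotomy p 0 with hp | hp | hp
    · obtain rfl : q = 0 := (mul_eq_zero.1 hpq).resolve_left hp.ne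
      exact ⟨fun _ => reducedStable_of_neg ha hp, fun hn => (hn (Or.inr (by simp [hp, hp.le]))).elim⟩
    · subst hp
      rcases lt_trichotomy (q * r) 0 with hqr | hqr | hqr
      · exact ⟨fun _ => reducedStable_of_center ha hqr,
          fun hn => (hn (Or.inr (by simp [hqr, hqr.le]))).elim⟩
      · by_cases hq : q = 0
        · subst hq
          by_cases hr : r = 0
          · subst hr
            exact ⟨fun _ => reducedStable_of_linear_zero, fun hn => (hn (by simp)).elim⟩
          · exact ⟨fun h => by simp [hr] at h, fun _ => reducedUnstable_of_snd_zero ha hr hν⟩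
        · obtain rfl : r = 0 := (mul_eq_zero.1 hqr).resolve_left hq
          exact ⟨fun h => by simp [hq] at h, fun _ => reducedUnstable_of_trd_zero ha hq hν⟩
      · refine ⟨fun h => ?_, fun _ => reducedUnstable_of_saddle ha hqr⟩
        rcases h with ⟨-, rfl, -⟩ | ⟨h, -⟩
        · simp at hqr
        · linarith
    · obtain rfl : q = 0 := (mul_eq_zero.1 hpq).resolve_left hp.ne'
      refine ⟨fun h => ?_, fun _ => reducedUnstable_of_pos ha hp⟩
      rcases h with ⟨rfl, -⟩ | ⟨-, h, -⟩
      · simp at hp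
      · linarith

/-! ### Global existence of solutions -/

/-- A bounded Lipschitz vector field has global integral curves. -/
theorem exists_forall_hasDerivAt_of_lipschitzWith {E : Type*} [NormedAddCommGroup E]
    [NormedSpace ℝ E] [CompleteSpace E] {G : E → E} {K L : ℝ≥0} (hG : LipschitzWith K G)
    (hL : ∀ x, ‖G x‖ ≤ L) (x₀ : E) :
    ∃ γ : ℝ → E, γ 0 = x₀ ∧ ∀ t, HasDerivAt γ (G (γ t)) t := by
  have hloc : ∀ T : ℝ, 0 < T → ∃ γ : ℝ → E, γ 0 = x₀ ∧
      ∀ t ∈ Ioo (-T) T, HasDerivAt γ (G (γ t)) t := fun T hT => by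
    have h0 : (0 : ℝ) ∈ Icc (-T) T := ⟨by linarith, hT.le⟩
    have hPL : IsPicardLindelof (fun _ => G) (⟨0, h0⟩ : Icc (-T) T) x₀ (L * T.toNNReal) 0 L K :=
      { lipschitzOnWith := fun _ _ => hG.lipschitzOnWith
        continuousOn := fun _ _ => continuousOn_const
        norm_le := fun _ _ x _ => hL x
        mul_max_le := by simp [hT.le] }
    obtain ⟨γ, hγ0, hγ⟩ := hPL.exists_eq_forall_mem_Icc_hasDerivWithinAt₀
    exact ⟨γ, hγ0, fun t ht =>
      (hγ t (Ioo_subset_Icc_self ht)).hasDerivAt (Icc_mem_nhds ht.1 ht.2)⟩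
  choose! γ hγ0 hγ using hloc
  have huniq : ∀ T T', 0 < T → T ≤ T' → EqOn (γ T) (γ T') (Ioo (-T) T) := fun T T' hT hTT' =>
    ODE_solution_unique_of_mem_Ioo (v := fun _ => G) (s := fun _ => univ) (t₀ := 0)
      (fun _ _ => hG.lipschitzOnWith) ⟨by linarith, hT⟩ (fun t ht => ⟨hγ T hT t ht, mem_univ _⟩)
      (fun t ht => ⟨hγ T' (hT.trans_le hTT') t ⟨by linarith [ht.1], by linarith [ht.2]⟩,
        mem_univ _⟩) (by rw [hγ0 T hT, hγ0 T' (hT.trans_le hTT')])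
  -- The local solutions are glued: the value at t comes from a solution whose interval contains t,
  -- and uniqueness makes the choice immaterial.
  refine ⟨fun t => γ (|t| + 1) t, hγ0 _ (by positivity), fun t => ?_⟩
  have hmem : ∀ u : ℝ, u ∈ Ioo (-(|u| + 1)) (|u| + 1) := fun u =>
    ⟨by linarith [neg_abs_le u], by linarith [le_abs_self u]⟩
  have heq : (fun u => γ (|u| + 1) u) =ᶠ[𝓝 t] γ (|t| + 2) := by
    filter_upwards [Metric.ball_mem_nhds t one_pos] with u hu
    rw [Metric.mem_ball, Real.dist_eq] at hu
    exact huniq _ _ (by positivity) (by linarith [abs_sub_abs_le_abs_sub u t]) (hmem u)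
  have ht := hγ (|t| + 2) (by positivity) t
    ⟨by linarith [neg_abs_le t], by linarith [le_abs_self t]⟩
  rw [← heq.eq_of_nhds] at ht
  exact ht.congr_of_eventuallyEq heq

/-- A smooth vector field that is tangent to all spheres about the origin has global integral
curves. -/
theorem exists_forall_hasDerivAt_of_inner_eq_zero {E : Type*} [NormedAddCommGroup E]
    [InnerProductSpace ℝ E] [FiniteDimensional ℝ E] {F : E → E} (hF : ContDiff ℝ 1 F)
    (hF0 : ∀ x, inner ℝ x (F x) = 0) (x₀ : E) :
    ∃ γ : ℝ → E, γ 0 = x₀ ∧ ∀ t, HasDerivAt γ (F (γ t)) t := by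
  -- The truncated field is still tangent to the spheres, so its orbit stays on the sphere of radius
  -- ‖x₀‖, where the cut-off equals 1.
  let ψ : ContDiffBump (0 : E) := ⟨‖x₀‖ + 1, ‖x₀‖ + 2, by positivity, by linarith⟩
  let G : E → E := fun x => ψ x • F x
  have hGs : HasCompactSupport G := ψ.hasCompactSupport.smul_right
  have hGd : ContDiff ℝ 1 G := ψ.contDiff.smul hF
  obtain ⟨K, hK⟩ := hGd.lipschitzWith_of_hasCompactSupport hGs one_ne_zero
  obtain ⟨L, hL⟩ := hGs.exists_bound_of_continuous hGd.continuous
  obtain ⟨γ, hγ0, hγ⟩ := exists_forall_hasDerivAt_of_lipschitzWith hK (L := L.toNNReal)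
    (fun x => (hL x).trans (Real.le_coe_toNNReal L)) x₀
  have hnorm : ∀ t, ‖γ t‖ ^ 2 = ‖x₀‖ ^ 2 := fun t => by
    rw [← hγ0]
    refine eq_of_hasDerivAt_zero (V := fun t => ‖γ t‖ ^ 2) (fun t => (hγ t).norm_sq)
      (fun t => ?_) t
    simp [G, inner_smul_right, hF0]
  refine ⟨γ, hγ0, fun t => ?_⟩
  have h1 : ‖γ t‖ = ‖x₀‖ := by
    rw [← abs_norm (γ t), ← abs_norm x₀]; exact (sq_eq_sq_iff_abs_eq_abs _ _).1 (hnorm t)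
  have h2 : ψ (γ t) = 1 := ψ.one_of_mem_closedBall (by
    simp only [mem_closedBall_zero_iff, h1, ψ]; linarith)
  have h3 := hγ t
  simpa only [G, h2, one_smul] using h3

namespace MetricLieAlgebra

variable {𝔤 : Type*} [MetricLieAlgebra 𝔤] [FiniteDimensional ℝ 𝔤]

theorem inner_eulerField (Y Z : 𝔤) : inner ℝ Z (eulerField Y) = inner ℝ Y ⁅Y, Z⁆ := by
  rw [real_inner_comm, eulerField, inner_adT]

theorem contDiff_eulerField : ContDiff ℝ 1 (eulerField : 𝔤 → 𝔤) := by
  let L : 𝔤 →ₗ[ℝ] 𝔤 →ₗ[ℝ] 𝔤 :=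
    { toFun := adT
      map_add' := fun Y Z => by simp only [adT, map_add]
      map_smul' := fun c Y => by simp [adT] }
  let B : 𝔤 →L[ℝ] 𝔤 →L[ℝ] 𝔤 := LinearMap.toContinuousLinearMap
    ((LinearMap.toContinuousLinearMap : (𝔤 →ₗ[ℝ] 𝔤) ≃ₗ[ℝ] (𝔤 →L[ℝ] 𝔤)).toLinearMap ∘ₗ L)
  exact B.contDiff.clm_apply contDiff_id

/-- The Euler equation has global solutions. -/
theorem exists_isEulerSolution (X : 𝔤) : ∃ Y : ℝ → 𝔤, Y 0 = X ∧ IsEulerSolution Y :=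
  exists_forall_hasDerivAt_of_inner_eq_zero contDiff_eulerField
    (fun x => by rw [inner_eulerField, lie_self, inner_zero_right]) X

theorem inner_linearisation (X Y Z : 𝔤) :
    inner ℝ Z (linearisation X Y) = inner ℝ Y ⁅X, Z⁆ + inner ℝ X ⁅Y, Z⁆ := by
  rw [real_inner_comm]
  show inner ℝ (adT X Y + adT Y X) Z = _
  rw [inner_add_left, inner_adT, inner_adT]

theorem isStationary_iff (X : 𝔤) : IsStationary X ↔ ∀ Z, inner ℝ X ⁅X, Z⁆ = 0 := by
  refine ⟨fun h Z => ?_, fun h => ?_⟩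
  · rw [← inner_eulerField, h, inner_zero_right]
  · exact ext_inner_left ℝ fun Z => by rw [inner_eulerField, h, inner_zero_right]

/-- The sum of the principal `2 × 2` minors is the second coefficient of the characteristic
polynomial. -/
theorem _root_.Matrix.charpoly_coeff_one_fin_three (M : Matrix (Fin 3) (Fin 3) ℝ) :
    M.charpoly.coeff 1 = (M 0 0 * M 1 1 - M 0 1 * M 1 0) + (M 0 0 * M 2 2 - M 0 2 * M 2 0) +
      (M 1 1 * M 2 2 - M 1 2 * M 2 1) := by
  have h : M.charpoly = Polynomial.X ^ 3 - Polynomial.C (M 0 0 + M 1 1 + M 2 2) * Polynomial.X ^ 2 +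
      Polynomial.C ((M 0 0 * M 1 1 - M 0 1 * M 1 0) + (M 0 0 * M 2 2 - M 0 2 * M 2 0) +
      (M 1 1 * M 2 2 - M 1 2 * M 2 1)) * Polynomial.X - Polynomial.C M.det := by
    rw [Matrix.charpoly, Matrix.det_fin_three, Matrix.det_fin_three]
    simp
    ring
  rw [h]
  simp only [Polynomial.coeff_sub, Polynomial.coeff_add, Polynomial.coeff_C_mul,
    Polynomial.coeff_X_pow, Polynomial.coeff_X_one, Polynomial.coeff_C]
  norm_num

variable (b : OrthonormalBasis (Fin 3) ℝ 𝔤)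

theorem sigma_one_eq (f : 𝔤 →ₗ[ℝ] 𝔤) : sigma 1 f =
    inner ℝ (b 0) (f (b 0)) + inner ℝ (b 1) (f (b 1)) + inner ℝ (b 2) (f (b 2)) := by
  have hfin : Module.finrank ℝ 𝔤 = 3 := by
    rw [Module.finrank_eq_card_basis b.toBasis, Fintype.card_fin]
  have h := (LinearMap.toMatrix b.toBasis b.toBasis f).trace_eq_neg_charpoly_coeff
  rw [LinearMap.charpoly_toMatrix, Fintype.card_fin] at h
  rw [sigma, hfin, pow_one, neg_one_mul, ← h, Matrix.trace_fin_three]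
  simp [LinearMap.toMatrix_apply, OrthonormalBasis.repr_apply_apply]

theorem sigma_two_eq (f : 𝔤 →ₗ[ℝ] 𝔤) : sigma 2 f =
    (inner ℝ (b 0) (f (b 0)) * inner ℝ (b 1) (f (b 1)) -
      inner ℝ (b 0) (f (b 1)) * inner ℝ (b 1) (f (b 0))) +
    (inner ℝ (b 0) (f (b 0)) * inner ℝ (b 2) (f (b 2)) -
      inner ℝ (b 0) (f (b 2)) * inner ℝ (b 2) (f (b 0))) +
    (inner ℝ (b 1) (f (b 1)) * inner ℝ (b 2) (f (b 2)) -
      inner ℝ (b 1) (f (b 2)) * inner ℝ (b 2) (f (b 1))) := by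
  have hfin : Module.finrank ℝ 𝔤 = 3 := by
    rw [Module.finrank_eq_card_basis b.toBasis, Fintype.card_fin]
  have h := (LinearMap.toMatrix b.toBasis b.toBasis f).charpoly_coeff_one_fin_three
  rw [LinearMap.charpoly_toMatrix] at h
  rw [sigma, hfin, neg_one_sq, one_mul]
  simpa [LinearMap.toMatrix_apply, OrthonormalBasis.repr_apply_apply] using h

omit [FiniteDimensional ℝ 𝔤] in
theorem orthonormalBasis_sum_three (Y : 𝔤) :
    Y = inner ℝ (b 0) Y • b 0 + inner ℝ (b 1) Y • b 1 + inner ℝ (b 2) Y • b 2 := by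
  conv_lhs => rw [← b.sum_repr' Y]
  rw [Fin.sum_univ_three]

omit [FiniteDimensional ℝ 𝔤] in
theorem linearMap_eq_zero_iff_inner (f : 𝔤 →ₗ[ℝ] 𝔤) :
    f = 0 ↔ ∀ i j, inner ℝ (b i) (f (b j)) = 0 := by
  refine ⟨fun h i j => by simp [h], fun h => b.toBasis.ext fun j => ?_⟩
  rw [b.coe_toBasis, orthonormalBasis_sum_three b (f (b j))]
  simp [h]

omit [FiniteDimensional ℝ 𝔤] in
theorem norm_sq_eq_three (Y : 𝔤) :
    ‖Y‖ ^ 2 = inner ℝ (b 0) Y ^ 2 + inner ℝ (b 1) Y ^ 2 + inner ℝ (b 2) Y ^ 2 := by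
  rw [← b.sum_sq_inner_right Y, Fin.sum_univ_three]

end MetricLieAlgebra

namespace MetricLieAlgebra

variable {𝔤 : Type*} [MetricLieAlgebra 𝔤]

theorem exists_orthonormalBasis_of_inner (hdim : Module.finrank ℝ 𝔤 = 3)
    {v : Fin 3 → 𝔤} (hv : Orthonormal ℝ v) :
    ∃ b : OrthonormalBasis (Fin 3) ℝ 𝔤, ∀ i, b i = v i := by
  have : FiniteDimensional ℝ 𝔤 := Module.finite_of_finrank_eq_succ hdim
  obtain ⟨b, hb⟩ := Orthonormal.exists_orthonormalBasis_extension_of_card_eq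
    (ι := Fin 3) (v := v) (s := univ) (by simpa using hdim)
    (hv.comp _ Subtype.val_injective)
  exact ⟨b, fun i => hb i (mem_univ i)⟩

theorem exists_orthonormalBasis_of_norm_eq_one [FiniteDimensional ℝ 𝔤]
    (hdim : Module.finrank ℝ 𝔤 = 3) {v : 𝔤} (hv : ‖v‖ = 1) :
    ∃ b : OrthonormalBasis (Fin 3) ℝ 𝔤, b 0 = v := by
  obtain ⟨b, hb⟩ := Orthonormal.exists_orthonormalBasis_extension_of_card_eq
    (ι := Fin 3) (v := fun _ => v) (s := {0}) (by simpa using hdim)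
    ⟨fun _ => hv, fun i j hij => (hij (Subsingleton.elim i j)).elim⟩
  exact ⟨b, hb 0 rfl⟩

/-! ### Adapted frames and the stability criterion -/

section Frame

variable (b : OrthonormalBasis (Fin 3) ℝ 𝔤)

theorem lie_basis_zero (Y : 𝔤) :
    ⁅Y, b 0⁆ = -(inner ℝ (b 1) Y • ⁅b 0, b 1⁆) - inner ℝ (b 2) Y • ⁅b 0, b 2⁆ := by
  conv_lhs => rw [orthonormalBasis_sum_three b Y]
  rw [add_lie, add_lie, smul_lie, smul_lie, smul_lie, lie_self, ← lie_skew (b 1) (b 0),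
    ← lie_skew (b 2) (b 0)]
  module

theorem lie_basis_one (Y : 𝔤) :
    ⁅Y, b 1⁆ = inner ℝ (b 0) Y • ⁅b 0, b 1⁆ - inner ℝ (b 2) Y • ⁅b 1, b 2⁆ := by
  conv_lhs => rw [orthonormalBasis_sum_three b Y]
  rw [add_lie, add_lie, smul_lie, smul_lie, smul_lie, lie_self, ← lie_skew (b 2) (b 1)]
  module

theorem lie_basis_two (Y : 𝔤) :
    ⁅Y, b 2⁆ = inner ℝ (b 0) Y • ⁅b 0, b 2⁆ + inner ℝ (b 1) Y • ⁅b 1, b 2⁆ := by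
  conv_lhs => rw [orthonormalBasis_sum_three b Y]
  rw [add_lie, add_lie, smul_lie, smul_lie, smul_lie, lie_self]
  module

end Frame

/-- An orthonormal frame whose first vector is a stationary direction, in which the bracket has
the given structure constants. -/
structure IsAdaptedFrame (b : OrthonormalBasis (Fin 3) ℝ 𝔤) (p q r s μ ν : ℝ) : Prop where
  lie_zero_one : ⁅b 0, b 1⁆ = p • b 1 + (q + μ) • b 2
  lie_zero_two : ⁅b 0, b 2⁆ = (r - μ) • b 1 + s • b 2
  lie_one_two : ⁅b 1, b 2⁆ = μ • b 0 + ν • b 1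

variable [FiniteDimensional ℝ 𝔤] {b : OrthonormalBasis (Fin 3) ℝ 𝔤} {p q r s μ ν a : ℝ}

namespace IsAdaptedFrame

omit [FiniteDimensional ℝ 𝔤] in
-- The components of the Jacobi identity are (p + s)μ = 0, sν = 0 and ν(q + μ) = 0.
theorem jacobi (h : IsAdaptedFrame b p q r s μ ν) : ν = 0 ∨ s = 0 ∧ p * q = 0 := by
  have hj : ⁅b 0, ⁅b 1, b 2⁆⁆ = ⁅⁅b 0, b 1⁆, b 2⁆ + ⁅b 1, ⁅b 0, b 2⁆⁆ := leibniz_lie _ _ _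
  rw [h.lie_one_two, h.lie_zero_one, h.lie_zero_two, lie_add, lie_smul, lie_smul, lie_self,
    add_lie, smul_lie, smul_lie, lie_self, lie_add, lie_smul, lie_smul, lie_self, h.lie_one_two,
    h.lie_zero_one] at hj
  have h0 := congrArg (inner ℝ (b 0)) hj
  have h1 := congrArg (inner ℝ (b 1)) hj
  have h2 := congrArg (inner ℝ (b 2)) hj
  simp [inner_add_right, inner_smul_right, b.inner_eq_ite] at h0 h1 h2
  by_cases hν : ν = 0
  · exact Or.inl hν
  · have hs : s = 0 := by
      have : s * ν = 0 := by linarith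
      exact (mul_eq_zero.1 this).resolve_right hν
    have hq : q + μ = 0 := h2.resolve_left hν
    refine Or.inr ⟨hs, ?_⟩
    rw [hs] at h0
    have : q = -μ := by linarith
    rw [this]; linarith

theorem inner_zero (h : IsAdaptedFrame b p q r s μ ν) (Y : 𝔤) :
    inner ℝ (b 0) (eulerField Y) = -(p * inner ℝ (b 1) Y ^ 2 +
      (q + r) * inner ℝ (b 1) Y * inner ℝ (b 2) Y + s * inner ℝ (b 2) Y ^ 2) := by
  rw [inner_eulerField, lie_basis_zero, h.lie_zero_one, h.lie_zero_two]
  simp only [inner_sub_right, inner_neg_right, inner_add_right, inner_smul_right,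
    real_inner_comm (b _) Y]
  ring

theorem inner_one (h : IsAdaptedFrame b p q r s μ ν) (Y : 𝔤) :
    inner ℝ (b 1) (eulerField Y) = inner ℝ (b 0) Y * (p * inner ℝ (b 1) Y +
      q * inner ℝ (b 2) Y) - ν * inner ℝ (b 1) Y * inner ℝ (b 2) Y := by
  rw [inner_eulerField, lie_basis_one, h.lie_zero_one, h.lie_one_two]
  simp only [inner_sub_right, inner_add_right, inner_smul_right, real_inner_comm (b _) Y]
  ring

theorem inner_two (h : IsAdaptedFrame b p q r s μ ν) (Y : 𝔤) :
    inner ℝ (b 2) (eulerField Y) = inner ℝ (b 0) Y * (r * inner ℝ (b 1) Y +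
      s * inner ℝ (b 2) Y) + ν * inner ℝ (b 1) Y ^ 2 := by
  rw [inner_eulerField, lie_basis_two, h.lie_zero_two, h.lie_one_two]
  simp only [inner_add_right, inner_smul_right, real_inner_comm (b _) Y]
  ring

theorem reducedSolution (h : IsAdaptedFrame b p q r s μ ν) {Y : ℝ → 𝔤} (hY : IsEulerSolution Y) :
    ReducedSolution p q r s ν (fun t => inner ℝ (b 0) (Y t)) (fun t => inner ℝ (b 1) (Y t))
      (fun t => inner ℝ (b 2) (Y t)) := by
  have hd : ∀ v : 𝔤, ∀ t, HasDerivAt (fun t => inner ℝ v (Y t)) (inner ℝ v (eulerField (Y t))) t :=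
    fun v t => ((hasDerivAt_const t v).inner ℝ (hY t)).congr_deriv (by simp)
  exact ⟨fun t => h.inner_zero (Y t) ▸ hd (b 0) t, fun t => h.inner_one (Y t) ▸ hd (b 1) t,
    fun t => h.inner_two (Y t) ▸ hd (b 2) t⟩

omit [FiniteDimensional ℝ 𝔤] in
theorem abs_inner_lt {Y : 𝔤} {ε : ℝ} (h : ‖Y - a • b 0‖ < ε) :
    |inner ℝ (b 0) Y - a| < ε ∧ |inner ℝ (b 1) Y| < ε ∧ |inner ℝ (b 2) Y| < ε := by
  have hb : ∀ i, |inner ℝ (b i) (Y - a • b 0)| < ε := fun i =>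
    ((abs_real_inner_le_norm _ _).trans (by simp)).trans_lt h
  have h0 := hb 0
  have h1 := hb 1
  have h2 := hb 2
  simp [inner_sub_right, inner_smul_right, b.inner_eq_ite] at h0 h1 h2
  exact ⟨h0, h1, h2⟩

omit [FiniteDimensional ℝ 𝔤] in
theorem norm_sub_lt {Y : 𝔤} {ε : ℝ} (hε : 0 < ε) (h0 : |inner ℝ (b 0) Y - a| < ε / 2)
    (h1 : |inner ℝ (b 1) Y| < ε / 2) (h2 : |inner ℝ (b 2) Y| < ε / 2) : ‖Y - a • b 0‖ < ε := by
  refine lt_of_pow_lt_pow_left₀ 2 hε.le ?_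
  rw [norm_sq_eq_three b]
  have e0 := sq_lt_sq' (abs_lt.1 h0).1 (abs_lt.1 h0).2
  have e1 := sq_lt_sq' (abs_lt.1 h1).1 (abs_lt.1 h1).2
  have e2 := sq_lt_sq' (abs_lt.1 h2).1 (abs_lt.1 h2).2
  simp [inner_sub_right, inner_smul_right, b.inner_eq_ite]
  nlinarith

theorem isStable (h : IsAdaptedFrame b p q r s μ ν) (hs : ReducedStable p q r s ν a) :
    IsStable (a • b 0) := by
  intro ε hε
  obtain ⟨δ, hδ, hst⟩ := hs (ε / 2) (by positivity)
  refine ⟨δ, hδ, fun Y hY h0 t ht => ?_⟩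
  obtain ⟨h1, h2, h3⟩ := abs_inner_lt h0
  obtain ⟨e1, e2, e3⟩ := hst _ _ _ (h.reducedSolution hY) h1 h2 h3 t ht
  exact norm_sub_lt hε e1 e2 e3

theorem not_isStable (h : IsAdaptedFrame b p q r s μ ν) (hu : ReducedUnstable p q r s ν a) :
    ¬ IsStable (a • b 0) := by
  intro hst
  obtain ⟨ε, hε, hu⟩ := hu
  obtain ⟨δ, hδ, hst⟩ := hst ε hε
  obtain ⟨x₀, y₀, z₀, hx, hy, hz, hu⟩ := hu (δ / 2) (by positivity)
  -- Stability constrains only global solutions, so one with the escaping initial value must be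
  -- produced.
  obtain ⟨Y, hY0, hY⟩ := exists_isEulerSolution (x₀ • b 0 + y₀ • b 1 + z₀ • b 2)
  have h0 : inner ℝ (b 0) (Y 0) = x₀ := by
    simp [hY0, inner_add_right, inner_smul_right, b.inner_eq_ite]
  have h1 : inner ℝ (b 1) (Y 0) = y₀ := by
    simp [hY0, inner_add_right, inner_smul_right, b.inner_eq_ite]
  have h2 : inner ℝ (b 2) (Y 0) = z₀ := by
    simp [hY0, inner_add_right, inner_smul_right, b.inner_eq_ite]
  exact hu _ _ _ (h.reducedSolution hY) h0 h1 h2 fun t ht => abs_inner_lt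
    (hst Y hY (norm_sub_lt hδ (by rwa [h0]) (by rwa [h1]) (by rwa [h2])) t ht)

theorem isStationary (h : IsAdaptedFrame b p q r s μ ν) : IsStationary (a • b 0) := by
  rw [isStationary_iff]
  intro Z
  rw [orthonormalBasis_sum_three b Z, smul_lie, lie_add, lie_add, lie_smul, lie_smul, lie_smul,
    lie_self, h.lie_zero_one, h.lie_zero_two]
  simp [inner_add_right, inner_smul_left, inner_smul_right, b.inner_eq_ite]

/-- The shifts by μ in the structure constants are chosen so that μ cancels here between ad^t_X Y
and ad^t_Y X. -/
theorem linearisation_entries (h : IsAdaptedFrame b p q r s μ ν) :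
    (∀ i, inner ℝ (b i) (linearisation (a • b 0) (b 0)) = 0) ∧
    (∀ i, inner ℝ (b 0) (linearisation (a • b 0) (b i)) = 0) ∧
    inner ℝ (b 1) (linearisation (a • b 0) (b 1)) = a * p ∧
    inner ℝ (b 1) (linearisation (a • b 0) (b 2)) = a * q ∧
    inner ℝ (b 2) (linearisation (a • b 0) (b 1)) = a * r ∧
    inner ℝ (b 2) (linearisation (a • b 0) (b 2)) = a * s := by
  have h10 : ⁅b 1, b 0⁆ = -(p • b 1 + (q + μ) • b 2) := by rw [← lie_skew, h.lie_zero_one]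
  have h20 : ⁅b 2, b 0⁆ = -((r - μ) • b 1 + s • b 2) := by rw [← lie_skew, h.lie_zero_two]
  have h21 : ⁅b 2, b 1⁆ = -(μ • b 0 + ν • b 1) := by rw [← lie_skew, h.lie_one_two]
  refine ⟨fun i => ?_, fun i => ?_, ?_, ?_, ?_, ?_⟩
  · fin_cases i <;> simp [inner_linearisation, h.lie_zero_one, h.lie_zero_two, inner_add_right,
      inner_smul_left, inner_smul_right, b.inner_eq_ite]
  · fin_cases i <;> simp [inner_linearisation, h10, h20, inner_add_right,
      inner_smul_left, inner_smul_right, b.inner_eq_ite]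
  all_goals
    simp [inner_linearisation, h.lie_zero_one, h.lie_zero_two, h.lie_one_two, h21,
      inner_add_right, inner_smul_left, inner_smul_right, b.inner_eq_ite]
    try ring

theorem sigma_one (h : IsAdaptedFrame b p q r s μ ν) :
    sigma 1 (linearisation (a • b 0)) = a * (p + s) := by
  obtain ⟨h1, h2, h3, h4, h5, h6⟩ := h.linearisation_entries (a := a)
  rw [sigma_one_eq b, h1, h3, h6]; ring

theorem sigma_two (h : IsAdaptedFrame b p q r s μ ν) :
    sigma 2 (linearisation (a • b 0)) = a ^ 2 * (p * s - q * r) := by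
  obtain ⟨h1, h2, h3, h4, h5, h6⟩ := h.linearisation_entries (a := a)
  rw [sigma_two_eq b, h1, h1, h1, h2, h2, h3, h4, h5, h6]; ring

theorem linearisation_eq_zero_iff (h : IsAdaptedFrame b p q r s μ ν) (ha : a ≠ 0) :
    linearisation (a • b 0) = 0 ↔ p = 0 ∧ q = 0 ∧ r = 0 ∧ s = 0 := by
  obtain ⟨h1, h2, h3, h4, h5, h6⟩ := h.linearisation_entries (a := a)
  rw [linearMap_eq_zero_iff_inner b]
  refine ⟨fun h0 => ?_, ?_⟩
  · rw [h0, eq_comm, mul_eq_zero, or_iff_right ha] at h3 h4 h5 h6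
    exact ⟨h3, h4, h5, h6⟩
  · rintro ⟨rfl, rfl, rfl, rfl⟩ i j
    rw [mul_zero] at h3 h4 h5 h6
    fin_cases i <;> fin_cases j
    exacts [h1 0, h2 1, h2 2, h1 1, h3, h4, h1 2, h5, h6]

end IsAdaptedFrame

/-- A rotation in b₀^⊥ leaves [b₁, b₂] unchanged, so b₁ can be aligned with the projection of that
bracket to the plane. Stationarity removes the b₀-components of [b₀, b₁] and [b₀, b₂]. -/
theorem exists_isAdaptedFrame (hdim : Module.finrank ℝ 𝔤 = 3) {X : 𝔤} (hX : IsStationary X)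
    (h0 : X ≠ 0) : ∃ (b : OrthonormalBasis (Fin 3) ℝ 𝔤) (p q r s μ ν : ℝ),
      IsAdaptedFrame b p q r s μ ν ∧ X = ‖X‖ • b 0 := by
  have hn : ‖X‖ ≠ 0 := norm_ne_zero_iff.2 h0
  obtain ⟨c, hc⟩ := exists_orthonormalBasis_of_norm_eq_one hdim (v := ‖X‖⁻¹ • X)
    (by rw [norm_smul, norm_inv, norm_norm, inv_mul_cancel₀ hn])
  have hXc : X = ‖X‖ • c 0 := by rw [hc, smul_inv_smul₀ hn]
  obtain ⟨k, l, hkl, hort⟩ : ∃ k l : ℝ, k ^ 2 + l ^ 2 = 1 ∧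
      -l * inner ℝ (c 1) ⁅c 1, c 2⁆ + k * inner ℝ (c 2) ⁅c 1, c 2⁆ = 0 := by
    set m := inner ℝ (c 1) ⁅c 1, c 2⁆
    set n := inner ℝ (c 2) ⁅c 1, c 2⁆
    by_cases hmn : m ^ 2 + n ^ 2 = 0
    · have hn : n = 0 := by nlinarith [sq_nonneg m, sq_nonneg n]
      exact ⟨1, 0, by simp, by simp [hn]⟩
    · have hpos : 0 < m ^ 2 + n ^ 2 := lt_of_le_of_ne (by positivity) (Ne.symm hmn)
      refine ⟨m / √(m ^ 2 + n ^ 2), n / √(m ^ 2 + n ^ 2), ?_, by ring⟩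
      rw [div_pow, div_pow, Real.sq_sqrt hpos.le, ← add_div, div_self hmn]
  obtain ⟨b, hb⟩ := exists_orthonormalBasis_of_inner hdim
    (v := ![c 0, k • c 1 + l • c 2, -l • c 1 + k • c 2]) (by
      rw [orthonormal_iff_ite]
      intro i j
      fin_cases i <;> fin_cases j <;>
        simp [inner_add_left, inner_add_right, inner_smul_left, inner_smul_right,
          c.inner_eq_ite, -inner_self_eq_norm_sq_to_K] <;> linarith)
  have hb0 : b 0 = c 0 := hb 0
  have hb1 : b 1 = k • c 1 + l • c 2 := hb 1
  have hb2 : b 2 = -l • c 1 + k • c 2 := hb 2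
  have h12 : ⁅b 1, b 2⁆ = ⁅c 1, c 2⁆ := by
    rw [hb1, hb2, lie_add, add_lie, add_lie, lie_smul, lie_smul, lie_smul, lie_smul, smul_lie,
      smul_lie, smul_lie, smul_lie, lie_self, lie_self, ← lie_skew (c 2) (c 1)]
    calc _ = (k ^ 2 + l ^ 2) • ⁅c 1, c 2⁆ := by module
      _ = _ := by rw [hkl, one_smul]
  have hb212 : inner ℝ (b 2) ⁅b 1, b 2⁆ = 0 := by
    rw [h12, hb2, inner_add_left, inner_smul_left, inner_smul_left]
    simpa using hort
  have hstat : ∀ Z, inner ℝ (b 0) ⁅b 0, Z⁆ = 0 := fun Z => by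
    have := (isStationary_iff X).1 hX Z
    rw [hXc, ← hb0, smul_lie, inner_smul_left, inner_smul_right] at this
    simpa [hn] using this
  refine ⟨b, inner ℝ (b 1) ⁅b 0, b 1⁆, inner ℝ (b 2) ⁅b 0, b 1⁆ - inner ℝ (b 0) ⁅b 1, b 2⁆,
    inner ℝ (b 1) ⁅b 0, b 2⁆ + inner ℝ (b 0) ⁅b 1, b 2⁆, inner ℝ (b 2) ⁅b 0, b 2⁆,
    inner ℝ (b 0) ⁅b 1, b 2⁆, inner ℝ (b 1) ⁅b 1, b 2⁆, ⟨?_, ?_, ?_⟩, by rw [hb0]; exact hXc⟩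
  · conv_lhs => rw [orthonormalBasis_sum_three b ⁅b 0, b 1⁆]
    rw [hstat]; module
  · conv_lhs => rw [orthonormalBasis_sum_three b ⁅b 0, b 2⁆]
    rw [hstat]; module
  · conv_lhs => rw [orthonormalBasis_sum_three b ⁅b 1, b 2⁆]
    rw [hb212]; module

theorem isStable_zero : IsStable (0 : 𝔤) := by
  intro ε hε
  refine ⟨ε, hε, fun Y hY h0 t _ => ?_⟩
  have h1 : ‖Y t‖ ^ 2 = ‖Y 0‖ ^ 2 := eq_of_hasDerivAt_zero (V := fun t => ‖Y t‖ ^ 2)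
    (fun t => (hY t).norm_sq)
    (fun t => by rw [inner_eulerField, lie_self, inner_zero_right, mul_zero]) t
  have h2 : ‖Y t‖ = ‖Y 0‖ := by
    rw [← abs_norm (Y t), ← abs_norm (Y 0)]; exact (sq_eq_sq_iff_abs_eq_abs _ _).1 h1
  rw [sub_zero] at h0 ⊢
  rwa [h2]

theorem isStable_iff (hdim : Module.finrank ℝ 𝔤 = 3) {X : 𝔤} (hX : IsStationary X) :
    IsStable X ↔ linearisation X = 0 ∨ (0 ≤ sigma 2 (linearisation X) ∧
      sigma 1 (linearisation X) ≤ 0 ∧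
      (0 < sigma 2 (linearisation X) ∨ sigma 1 (linearisation X) < 0)) := by
  by_cases h0 : X = 0
  · subst h0
    refine iff_of_true isStable_zero (Or.inl ?_)
    ext Y
    simp [linearisation, adT]
  · obtain ⟨b, p, q, r, s, μ, ν, h, hXb⟩ := exists_isAdaptedFrame hdim hX h0
    have ha : 0 < ‖X‖ := norm_pos_iff.2 h0
    have hle : ‖X‖ * (p + s) ≤ 0 ↔ p + s ≤ 0 :=
      ⟨fun h => by by_contra! h'; linarith [mul_pos ha h'],
        fun h => mul_nonpos_of_nonneg_of_nonpos ha.le h⟩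
    have hlt : ‖X‖ * (p + s) < 0 ↔ p + s < 0 :=
      ⟨fun h => by by_contra! h'; linarith [mul_nonneg ha.le h'], mul_neg_of_pos_of_neg ha⟩
    rw [hXb, h.sigma_one, h.sigma_two, h.linearisation_eq_zero_iff ha.ne',
      mul_nonneg_iff_of_pos_left (pow_pos ha 2), mul_pos_iff_of_pos_left (pow_pos ha 2),
      hle, hlt]
    have hr := reducedStable_or_reducedUnstable (r := r) ha h.jacobi
    refine ⟨fun hst => ?_, fun hc => h.isStable (hr.1 hc)⟩
    by_contra hc
    exact h.not_isStable (hr.2 hc) hst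

end MetricLieAlgebra

/-! ### Unimodular algebras and Milnor frames -/

namespace MetricLieAlgebra

variable {𝔤 : Type*} [MetricLieAlgebra 𝔤]

/-- Milnor's normal form of a unimodular metric Lie algebra. -/
structure IsDiagonalFrame (b : OrthonormalBasis (Fin 3) ℝ 𝔤) (μ₀ μ₁ μ₂ : ℝ) : Prop where
  lie_one_two : ⁅b 1, b 2⁆ = μ₀ • b 0
  lie_two_zero : ⁅b 2, b 0⁆ = μ₁ • b 1
  lie_zero_one : ⁅b 0, b 1⁆ = μ₂ • b 2

namespace IsDiagonalFrame

variable {b : OrthonormalBasis (Fin 3) ℝ 𝔤} {μ μ₀ μ₁ μ₂ : ℝ}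

theorem rotate (h : IsDiagonalFrame b μ₀ μ₁ μ₂) :
    IsDiagonalFrame (b.reindex (finRotate 3).symm) μ₁ μ₂ μ₀ := by
  have h0 : b.reindex (finRotate 3).symm 0 = b 1 := by simp
  have h1 : b.reindex (finRotate 3).symm 1 = b 2 := by simp
  have h2 : b.reindex (finRotate 3).symm 2 = b 0 := by simp
  exact ⟨by rw [h0, h1, h2]; exact h.lie_two_zero, by rw [h0, h1, h2]; exact h.lie_zero_one,
    by rw [h0, h1, h2]; exact h.lie_one_two⟩

/-- Thus at b₀ one has σ₁ = 0 and σ₂ = (μ₁ - μ₀)(μ₂ - μ₀). -/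
theorem isAdaptedFrame (h : IsDiagonalFrame b μ₀ μ₁ μ₂) :
    IsAdaptedFrame b 0 (μ₂ - μ₀) (μ₀ - μ₁) 0 μ₀ 0 := by
  refine ⟨?_, ?_, ?_⟩
  · rw [h.lie_zero_one]; module
  · rw [← lie_skew, h.lie_two_zero]; module
  · rw [h.lie_one_two]; module

theorem isStable [FiniteDimensional ℝ 𝔤] (h : IsDiagonalFrame b μ₀ μ₁ μ₂)
    (hμ : 0 < (μ₁ - μ₀) * (μ₂ - μ₀) ∨ μ₁ = μ₀ ∧ μ₂ = μ₀) : IsStable (b 0) := by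
  rw [← one_smul ℝ (b 0)]
  refine h.isAdaptedFrame.isStable ((reducedStable_or_reducedUnstable one_pos (Or.inl rfl)).1 ?_)
  rcases hμ with hμ | ⟨rfl, rfl⟩
  · exact Or.inr ⟨by linarith, by simp, Or.inl (by linarith)⟩
  · simp

theorem not_isStable [FiniteDimensional ℝ 𝔤] (h : IsDiagonalFrame b μ₀ μ₁ μ₂)
    (hμ : (μ₁ - μ₀) * (μ₂ - μ₀) ≤ 0) (hne : ¬ (μ₁ = μ₀ ∧ μ₂ = μ₀)) : ¬ IsStable (b 0) := by
  rw [← one_smul ℝ (b 0)]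
  refine h.isAdaptedFrame.not_isStable
    ((reducedStable_or_reducedUnstable one_pos (Or.inl rfl)).2 ?_)
  rintro (⟨-, h1, h2, -⟩ | ⟨-, -, h1 | h1⟩)
  · exact hne ⟨by linarith, by linarith⟩
  · linarith
  · simp at h1

theorem isStationary [FiniteDimensional ℝ 𝔤] (h : IsDiagonalFrame b μ₀ μ₁ μ₂) :
    IsStationary (b 0) := by
  rw [← one_smul ℝ (b 0)]
  exact h.isAdaptedFrame.isStationary

theorem exists_isStable [FiniteDimensional ℝ 𝔤] (h : IsDiagonalFrame b μ₀ μ₁ μ₂) :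
    ∃ X : 𝔤, X ≠ 0 ∧ IsStationary X ∧ IsStable X := by
  by_cases h0 : 0 < (μ₁ - μ₀) * (μ₂ - μ₀)
  · exact ⟨_, b.orthonormal.ne_zero 0, h.isStationary, h.isStable (Or.inl h0)⟩
  by_cases h1 : 0 < (μ₂ - μ₁) * (μ₀ - μ₁)
  · exact ⟨_, (b.reindex _).orthonormal.ne_zero 0, h.rotate.isStationary,
      h.rotate.isStable (Or.inl h1)⟩
  by_cases h2 : 0 < (μ₀ - μ₂) * (μ₁ - μ₂)
  · exact ⟨_, ((b.reindex _).reindex _).orthonormal.ne_zero 0, h.rotate.rotate.isStationary,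
      h.rotate.rotate.isStable (Or.inl h2)⟩
  refine ⟨_, b.orthonormal.ne_zero 0, h.isStationary, h.isStable (Or.inr ⟨?_, ?_⟩)⟩
  -- The three products add up to half the sum of the squared differences, so if none is positive
  -- all constants agree.
  · nlinarith [sq_nonneg (μ₁ - μ₀), sq_nonneg (μ₂ - μ₀), sq_nonneg (μ₁ - μ₂)]
  · nlinarith [sq_nonneg (μ₁ - μ₀), sq_nonneg (μ₂ - μ₀), sq_nonneg (μ₁ - μ₂)]

theorem exists_not_isStable [FiniteDimensional ℝ 𝔤] (h : IsDiagonalFrame b μ₀ μ₁ μ₂)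
    (hne : ¬ (μ₁ = μ₀ ∧ μ₂ = μ₀)) : ∃ X : 𝔤, IsStationary X ∧ ¬ IsStable X := by
  by_cases h0 : (μ₁ - μ₀) * (μ₂ - μ₀) ≤ 0
  · exact ⟨_, h.isStationary, h.not_isStable h0 hne⟩
  by_cases h1 : (μ₂ - μ₁) * (μ₀ - μ₁) ≤ 0
  · exact ⟨_, h.rotate.isStationary, h.rotate.not_isStable h1
      fun hn => hne ⟨by linarith, by linarith⟩⟩
  refine ⟨_, h.rotate.rotate.isStationary, h.rotate.rotate.not_isStable ?_
    fun hn => hne ⟨by linarith, by linarith⟩⟩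
  push Not at h0 h1
  have h01 := mul_pos h0 h1
  by_contra! h2
  have := mul_pos h01 h2
  -- The product of the three values of σ₂ is minus a square, so they cannot all be positive.
  nlinarith [sq_nonneg ((μ₁ - μ₀) * (μ₂ - μ₀) * (μ₂ - μ₁))]

theorem lie_eq (h : IsDiagonalFrame b μ μ μ) (Y Z : 𝔤) : ⁅Y, Z⁆ =
    (μ * (inner ℝ (b 1) Y * inner ℝ (b 2) Z - inner ℝ (b 2) Y * inner ℝ (b 1) Z)) • b 0 +
    (μ * (inner ℝ (b 2) Y * inner ℝ (b 0) Z - inner ℝ (b 0) Y * inner ℝ (b 2) Z)) • b 1 +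
    (μ * (inner ℝ (b 0) Y * inner ℝ (b 1) Z - inner ℝ (b 1) Y * inner ℝ (b 0) Z)) • b 2 := by
  conv_lhs => rw [orthonormalBasis_sum_three b Z]
  rw [lie_add, lie_add, lie_smul, lie_smul, lie_smul, lie_basis_zero b Y,
    lie_basis_one b Y, lie_basis_two b Y, ← lie_skew (b 0) (b 2), h.lie_zero_one, h.lie_two_zero, h.lie_one_two]
  module

theorem inner_lie (h : IsDiagonalFrame b μ μ μ) (Y Z : 𝔤) :
    inner ℝ (b 0) ⁅Y, Z⁆ =
      μ * (inner ℝ (b 1) Y * inner ℝ (b 2) Z - inner ℝ (b 2) Y * inner ℝ (b 1) Z) ∧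
    inner ℝ (b 1) ⁅Y, Z⁆ =
      μ * (inner ℝ (b 2) Y * inner ℝ (b 0) Z - inner ℝ (b 0) Y * inner ℝ (b 2) Z) ∧
    inner ℝ (b 2) ⁅Y, Z⁆ =
      μ * (inner ℝ (b 0) Y * inner ℝ (b 1) Z - inner ℝ (b 1) Y * inner ℝ (b 0) Z) := by
  rw [h.lie_eq Y Z]
  refine ⟨?_, ?_, ?_⟩ <;>
    simp [inner_add_right, inner_smul_right, b.inner_eq_ite]

theorem isBiInvariant (h : IsDiagonalFrame b μ μ μ) : IsBiInvariant 𝔤 := by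
  intro X Y Z
  rw [h.lie_eq Z X, h.lie_eq Z Y]
  simp only [inner_add_left, inner_add_right, inner_smul_left, inner_smul_right,
    real_inner_comm (b _) X]
  simp
  ring

/-- The skew matrix of the cross product with `μ Y`, in coordinates. -/
noncomputable def skewMatrix (b : OrthonormalBasis (Fin 3) ℝ 𝔤) (μ : ℝ) (Y : 𝔤) :
    Matrix (Fin 3) (Fin 3) ℝ :=
  !![0, -(μ * inner ℝ (b 2) Y), μ * inner ℝ (b 1) Y;
    μ * inner ℝ (b 2) Y, 0, -(μ * inner ℝ (b 0) Y);
    -(μ * inner ℝ (b 1) Y), μ * inner ℝ (b 0) Y, 0]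

theorem skewMatrix_mem_so (b : OrthonormalBasis (Fin 3) ℝ 𝔤) (μ : ℝ) (Y : 𝔤) :
    skewMatrix b μ Y ∈ LieAlgebra.Orthogonal.so (Fin 3) ℝ := by
  rw [LieAlgebra.Orthogonal.mem_so]
  ext i j
  fin_cases i <;> fin_cases j <;> simp [skewMatrix]

theorem skewMatrix_lie (h : IsDiagonalFrame b μ μ μ) (Y Z : 𝔤) : skewMatrix b μ ⁅Y, Z⁆ =
    skewMatrix b μ Y * skewMatrix b μ Z - skewMatrix b μ Z * skewMatrix b μ Y := by
  obtain ⟨h0, h1, h2⟩ := h.inner_lie Y Z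
  rw [skewMatrix, h0, h1, h2]
  ext i j
  fin_cases i <;> fin_cases j <;>
    simp [skewMatrix] <;> ring

theorem exists_skewMatrix_eq (b : OrthonormalBasis (Fin 3) ℝ 𝔤) (hμ : μ ≠ 0)
    {A : Matrix (Fin 3) (Fin 3) ℝ} (hA : A ∈ LieAlgebra.Orthogonal.so (Fin 3) ℝ) :
    ∃ Y, skewMatrix b μ Y = A := by
  rw [LieAlgebra.Orthogonal.mem_so] at hA
  have hA' : ∀ i j, A j i = -A i j := fun i j => congrFun (congrFun hA i) j
  have hd : ∀ i, A i i = 0 := fun i => by linarith [hA' i i]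
  obtain ⟨Y, h0, h1, h2⟩ : ∃ Y : 𝔤, μ * inner ℝ (b 0) Y = A 2 1 ∧
      μ * inner ℝ (b 1) Y = A 0 2 ∧ μ * inner ℝ (b 2) Y = A 1 0 :=
    ⟨(μ⁻¹ * A 2 1) • b 0 + (μ⁻¹ * A 0 2) • b 1 + (μ⁻¹ * A 1 0) • b 2,
      by simp [inner_add_right, inner_smul_right, b.inner_eq_ite, hμ],
      by simp [inner_add_right, inner_smul_right, b.inner_eq_ite, hμ],
      by simp [inner_add_right, inner_smul_right, b.inner_eq_ite, hμ]⟩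
  refine ⟨Y, ?_⟩
  rw [skewMatrix, h0, h1, h2, ← hA' 1 0, ← hA' 2 1, ← hA' 0 2]
  conv_rhs => rw [Matrix.eta_fin_three A, hd, hd, hd]

theorem skewMatrix_injective (b : OrthonormalBasis (Fin 3) ℝ 𝔤) (hμ : μ ≠ 0) :
    Function.Injective (skewMatrix b μ) := fun Y Z hYZ => by
  have h0 := congrFun (congrFun hYZ 2) 1
  have h1 := congrFun (congrFun hYZ 0) 2
  have h2 := congrFun (congrFun hYZ 1) 0
  simp [skewMatrix, hμ] at h0 h1 h2
  rw [orthonormalBasis_sum_three b Y, orthonormalBasis_sum_three b Z, h0, h1, h2]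

/-- The Lie algebra with `[b₁, b₂] = μ b₀` and cyclically is `so(3)`. -/
theorem nonempty_lieEquiv_so (h : IsDiagonalFrame b μ μ μ) (hμ : μ ≠ 0) :
    Nonempty (𝔤 ≃ₗ⁅ℝ⁆ LieAlgebra.Orthogonal.so (Fin 3) ℝ) := by
  let φ : 𝔤 →ₗ⁅ℝ⁆ LieAlgebra.Orthogonal.so (Fin 3) ℝ :=
    { toFun := fun Y => ⟨skewMatrix b μ Y, skewMatrix_mem_so b μ Y⟩
      map_add' := fun Y Z => Subtype.ext (by
        ext i j
        fin_cases i <;> fin_cases j <;> simp [skewMatrix, inner_add_right] <;> ring)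
      map_smul' := fun c Y => Subtype.ext (by
        ext i j
        fin_cases i <;> fin_cases j <;> simp [skewMatrix, inner_smul_right] <;> ring)
      map_lie' := fun {Y Z} => Subtype.ext (h.skewMatrix_lie Y Z) }
  refine ⟨LieEquiv.ofBijective φ ⟨fun Y Z hYZ => ?_, fun A => ?_⟩⟩
  · exact skewMatrix_injective b hμ (congrArg Subtype.val hYZ)
  · obtain ⟨Y, hY⟩ := exists_skewMatrix_eq b hμ A.2
    exact ⟨Y, Subtype.ext hY⟩

end IsDiagonalFrame

variable [FiniteDimensional ℝ 𝔤]

omit [FiniteDimensional ℝ 𝔤] in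
theorem trace_ad_eq (b : OrthonormalBasis (Fin 3) ℝ 𝔤) (Y : 𝔤) :
    LinearMap.trace ℝ 𝔤 (LieAlgebra.ad ℝ 𝔤 Y) =
      inner ℝ (b 0) ⁅Y, b 0⁆ + inner ℝ (b 1) ⁅Y, b 1⁆ + inner ℝ (b 2) ⁅Y, b 2⁆ := by
  rw [LinearMap.trace_eq_sum_inner _ b, Fin.sum_univ_three]
  simp only [LieAlgebra.ad_apply]

omit [FiniteDimensional ℝ 𝔤] in
theorem trace_ad_lie (Y Z : 𝔤) : LinearMap.trace ℝ 𝔤 (LieAlgebra.ad ℝ 𝔤 ⁅Y, Z⁆) = 0 := by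
  have h : LieAlgebra.ad ℝ 𝔤 ⁅Y, Z⁆ = LieAlgebra.ad ℝ 𝔤 Y * LieAlgebra.ad ℝ 𝔤 Z -
      LieAlgebra.ad ℝ 𝔤 Z * LieAlgebra.ad ℝ 𝔤 Y := by
    ext W
    simp
  rw [h, map_sub, LinearMap.trace_mul_comm, sub_self]

/-- Milnor's argument: the map L with [u, v] = L(u × v) is self-adjoint because every ad_Y has trace
zero, and its eigenvectors form the frame. -/
theorem exists_isDiagonalFrame (hdim : Module.finrank ℝ 𝔤 = 3)
    (huni : ∀ Y : 𝔤, LinearMap.trace ℝ 𝔤 (LieAlgebra.ad ℝ 𝔤 Y) = 0) :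
    ∃ (b : OrthonormalBasis (Fin 3) ℝ 𝔤) (μ₀ μ₁ μ₂ : ℝ), IsDiagonalFrame b μ₀ μ₁ μ₂ := by
  let e : OrthonormalBasis (Fin 3) ℝ 𝔤 := (stdOrthonormalBasis ℝ 𝔤).reindex (finCongr hdim)
  let L : 𝔤 →ₗ[ℝ] 𝔤 := e.toBasis.constr ℝ ![⁅e 1, e 2⁆, ⁅e 2, e 0⁆, ⁅e 0, e 1⁆]
  have hL0 : L (e 0) = ⁅e 1, e 2⁆ :=
    (congrArg L (congrFun e.coe_toBasis 0).symm).trans (e.toBasis.constr_basis ℝ _ 0)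
  have hL1 : L (e 1) = ⁅e 2, e 0⁆ :=
    (congrArg L (congrFun e.coe_toBasis 1).symm).trans (e.toBasis.constr_basis ℝ _ 1)
  have hL2 : L (e 2) = ⁅e 0, e 1⁆ :=
    (congrArg L (congrFun e.coe_toBasis 2).symm).trans (e.toBasis.constr_basis ℝ _ 2)
  have t0 := huni (e 0)
  have t1 := huni (e 1)
  have t2 := huni (e 2)
  rw [trace_ad_eq e, lie_self, inner_zero_right] at t0 t1 t2
  rw [← lie_skew (e 0) (e 2), inner_neg_right] at t0
  rw [← lie_skew (e 1) (e 0), inner_neg_right] at t1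
  rw [← lie_skew (e 2) (e 1), inner_neg_right] at t2
  have hsymm : L.IsSymmetric := by
    have hbasis : ∀ i j, inner ℝ (L (e i)) (e j) = inner ℝ (e i) (L (e j)) := fun i j => by
      rw [real_inner_comm (e j)]
      fin_cases i <;> fin_cases j <;> simp [hL0, hL1, hL2] <;> linarith
    intro Y Z
    rw [orthonormalBasis_sum_three e Y, orthonormalBasis_sum_three e Z]
    simp only [map_add, map_smul, inner_add_left, inner_add_right, inner_smul_left,
      inner_smul_right, hbasis]
  let b := hsymm.eigenvectorBasis hdim
  -- For an eigenvector, ⟨bᵢ, L(bᵢ × Z)⟩ is a multiple of ⟨bᵢ, bᵢ × Z⟩ = 0. This already forces the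
  -- diagonal form, whatever the orientation of b.
  have hstat : ∀ i Z, inner ℝ (b i) ⁅b i, Z⁆ = 0 := fun i Z => by
    have hlie : ⁅b i, Z⁆ = L (
        (inner ℝ (e 1) (b i) * inner ℝ (e 2) Z - inner ℝ (e 2) (b i) * inner ℝ (e 1) Z) • e 0 +
        (inner ℝ (e 2) (b i) * inner ℝ (e 0) Z - inner ℝ (e 0) (b i) * inner ℝ (e 2) Z) • e 1 +
        (inner ℝ (e 0) (b i) * inner ℝ (e 1) Z - inner ℝ (e 1) (b i) * inner ℝ (e 0) Z) • e 2) := by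
      conv_lhs => rw [orthonormalBasis_sum_three e Z]
      rw [lie_add, lie_add, lie_smul, lie_smul, lie_smul, lie_basis_zero e (b i),
        lie_basis_one e (b i), lie_basis_two e (b i), ← lie_skew (e 0) (e 2)]
      simp only [map_add, map_smul, hL0, hL1, hL2]
      module
    rw [hlie, ← hsymm, hsymm.apply_eigenvectorBasis]
    simp only [inner_smul_left, inner_add_right, inner_smul_right]
    simp only [real_inner_comm (e _)]
    simp only [b]
    ring
  have hstat' : ∀ i Z, inner ℝ (b i) ⁅Z, b i⁆ = 0 := fun i Z => by
    rw [← lie_skew, inner_neg_right, hstat, neg_zero]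
  refine ⟨b, inner ℝ (b 0) ⁅b 1, b 2⁆, inner ℝ (b 1) ⁅b 2, b 0⁆, inner ℝ (b 2) ⁅b 0, b 1⁆,
    ?_, ?_, ?_⟩
  · conv_lhs => rw [orthonormalBasis_sum_three b ⁅b 1, b 2⁆]
    rw [hstat, hstat']; module
  · conv_lhs => rw [orthonormalBasis_sum_three b ⁅b 2, b 0⁆]
    rw [hstat, hstat']; module
  · conv_lhs => rw [orthonormalBasis_sum_three b ⁅b 0, b 1⁆]
    rw [hstat, hstat']; module

/-! ### Non-unimodular algebras and the existence statements -/

/-- Commutators have trace zero, so all brackets lie in v^⊥. On this plane tr ad vanishes, which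
forces [b₁, b₂] = 0. -/
theorem exists_isAdaptedFrame_of_trace_ad (hdim : Module.finrank ℝ 𝔤 = 3) {v : 𝔤} (hv : ‖v‖ = 1)
    {c : ℝ} (hc : c ≠ 0)
    (htr : ∀ Y : 𝔤, LinearMap.trace ℝ 𝔤 (LieAlgebra.ad ℝ 𝔤 Y) = c * inner ℝ v Y) :
    ∃ (b : OrthonormalBasis (Fin 3) ℝ 𝔤) (p q r s : ℝ),
      IsAdaptedFrame b p q r s 0 0 ∧ p + s = c ∧ b 0 = v := by
  obtain ⟨b, hb⟩ := exists_orthonormalBasis_of_norm_eq_one hdim hv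
  subst hb
  have hperp : ∀ Y Z, inner ℝ (b 0) ⁅Y, Z⁆ = 0 := fun Y Z => by
    have := trace_ad_lie Y Z
    rw [htr] at this
    exact (mul_eq_zero.1 this).resolve_left hc
  have t0 := htr (b 0)
  have t1 := htr (b 1)
  have t2 := htr (b 2)
  rw [trace_ad_eq b, hperp, zero_add] at t0 t1 t2
  rw [lie_self, inner_zero_right, b.inner_eq_ite] at t1 t2
  simp at t0 t1 t2
  rw [← lie_skew, inner_neg_right, neg_eq_zero] at t2
  refine ⟨b, inner ℝ (b 1) ⁅b 0, b 1⁆, inner ℝ (b 2) ⁅b 0, b 1⁆, inner ℝ (b 1) ⁅b 0, b 2⁆,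
    inner ℝ (b 2) ⁅b 0, b 2⁆, ⟨?_, ?_, ?_⟩, t0, rfl⟩
  · conv_lhs => rw [orthonormalBasis_sum_three b ⁅b 0, b 1⁆]
    rw [hperp]; module
  · conv_lhs => rw [orthonormalBasis_sum_three b ⁅b 0, b 2⁆]
    rw [hperp]; module
  · conv_lhs => rw [orthonormalBasis_sum_three b ⁅b 1, b 2⁆]
    rw [hperp, t1, t2]; module

theorem exists_trace_ad_eq_inner
    (huni : ¬ ∀ Y : 𝔤, LinearMap.trace ℝ 𝔤 (LieAlgebra.ad ℝ 𝔤 Y) = 0) :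
    ∃ (v : 𝔤) (c : ℝ), ‖v‖ = 1 ∧ 0 < c ∧
      ∀ Y : 𝔤, LinearMap.trace ℝ 𝔤 (LieAlgebra.ad ℝ 𝔤 Y) = c * inner ℝ v Y := by
  let ℓ : 𝔤 →ₗ[ℝ] ℝ := LinearMap.trace ℝ 𝔤 ∘ₗ (LieAlgebra.ad ℝ 𝔤 : 𝔤 →ₗ[ℝ] Module.End ℝ 𝔤)
  let u : 𝔤 := (InnerProductSpace.toDual ℝ 𝔤).symm (LinearMap.toContinuousLinearMap ℓ)
  have hu : ∀ Y, LinearMap.trace ℝ 𝔤 (LieAlgebra.ad ℝ 𝔤 Y) = inner ℝ u Y := fun Y => by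
    simp [u, ℓ]
  have hu0 : ‖u‖ ≠ 0 := fun h => huni fun Y => by
    rw [hu, norm_eq_zero.1 h, inner_zero_left]
  refine ⟨‖u‖⁻¹ • u, ‖u‖, by rw [norm_smul, norm_inv, norm_norm, inv_mul_cancel₀ hu0],
    lt_of_le_of_ne (norm_nonneg _) hu0.symm, fun Y => ?_⟩
  rw [hu, inner_smul_left]
  simp [hu0]

/-- If det M ≥ 0, b₀ itself is stable. If det M < 0, the quadratic form of M on b₀^⊥ has a nonzero
isotropic vector; it is stationary with σ₁ = 0 and σ₂ > 0. -/
theorem IsAdaptedFrame.exists_isStable (hdim : Module.finrank ℝ 𝔤 = 3)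
    {b : OrthonormalBasis (Fin 3) ℝ 𝔤} {p q r s : ℝ}
    (h : IsAdaptedFrame b p q r s 0 0) (hps : p + s < 0) :
    ∃ X : 𝔤, X ≠ 0 ∧ IsStationary X ∧ IsStable X := by
  by_cases hd : 0 ≤ p * s - q * r
  · exact ⟨(1 : ℝ) • b 0, by rw [one_smul]; exact b.orthonormal.ne_zero 0, h.isStationary,
      h.isStable ((reducedStable_or_reducedUnstable one_pos (Or.inl rfl)).1
        (Or.inr ⟨hd, hps.le, Or.inr hps⟩))⟩
  push Not at hd
  obtain ⟨y, z, hyz, hQ⟩ : ∃ y z : ℝ, 0 < y ^ 2 + z ^ 2 ∧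
      p * y ^ 2 + (q + r) * y * z + s * z ^ 2 = 0 := by
    by_cases hp : p = 0
    · exact ⟨1, 0, by norm_num, by simp [hp]⟩
    -- The discriminant equals (q - r)² - 4 det M.
    · have hD : 0 ≤ (q + r) ^ 2 - 4 * p * s := by nlinarith [sq_nonneg (q - r)]
      refine ⟨(-(q + r) + √((q + r) ^ 2 - 4 * p * s)) / (2 * p), 1, by positivity, ?_⟩
      have := Real.sq_sqrt hD
      generalize √((q + r) ^ 2 - 4 * p * s) = S at this
      field_simp
      linear_combination this
  have h10 : ⁅b 1, b 0⁆ = -(p • b 1 + q • b 2) := by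
    rw [← lie_skew, h.lie_zero_one, add_zero]
  have h20 : ⁅b 2, b 0⁆ = -(r • b 1 + s • b 2) := by
    rw [← lie_skew, h.lie_zero_two, sub_zero]
  have h01 : ⁅b 0, b 1⁆ = p • b 1 + q • b 2 := by rw [h.lie_zero_one, add_zero]
  have h02 : ⁅b 0, b 2⁆ = r • b 1 + s • b 2 := by rw [h.lie_zero_two, sub_zero]
  have h12 : ⁅b 1, b 2⁆ = 0 := by rw [h.lie_one_two]; simp
  have h21 : ⁅b 2, b 1⁆ = 0 := by rw [← lie_skew, h12, neg_zero]
  have hX : IsStationary (y • b 1 + z • b 2) := by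
    rw [isStationary_iff]
    intro Z
    rw [orthonormalBasis_sum_three b Z]
    simp [h10, h20, h12, h21, inner_add_left, inner_add_right, inner_smul_left, inner_smul_right,
      b.inner_eq_ite, -inner_self_eq_norm_sq_to_K]
    linear_combination (-inner ℝ (b 0) Z) * hQ
  refine ⟨_, fun h0 => ?_, hX, (isStable_iff hdim hX).2 (Or.inr ?_)⟩
  · have e1 := congrArg (inner ℝ (b 1)) h0
    have e2 := congrArg (inner ℝ (b 2)) h0
    simp [inner_add_right, inner_smul_right, b.inner_eq_ite] at e1 e2
    simp [e1, e2] at hyz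
  have h1 : sigma 1 (linearisation (y • b 1 + z • b 2)) = 0 := by
    rw [sigma_one_eq b]
    simp [inner_linearisation, h10, h20, h12, h21, inner_add_right, inner_smul_right,
      b.inner_eq_ite]
  have h2 : sigma 2 (linearisation (y • b 1 + z • b 2)) =
      (p * y + q * z) ^ 2 + (r * y + s * z) ^ 2 - (p * s - q * r) * (y ^ 2 + z ^ 2) := by
    rw [sigma_two_eq b]
    simp [inner_linearisation, h10, h20, h12, h21, h01, h02, inner_add_left, inner_add_right,
      inner_smul_left, inner_smul_right, b.inner_eq_ite]
    linear_combination (p + s) * hQ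
  have h3 : 0 < sigma 2 (linearisation (y • b 1 + z • b 2)) := by
    rw [h2]
    have := mul_pos (neg_pos.2 hd) hyz
    linarith [sq_nonneg (p * y + q * z), sq_nonneg (r * y + s * z)]
  exact ⟨h3.le, h1.le, Or.inl h3⟩

theorem IsAdaptedFrame.not_isStable_of_trace_pos {b : OrthonormalBasis (Fin 3) ℝ 𝔤} {p q r s : ℝ}
    (h : IsAdaptedFrame b p q r s 0 0) (hps : 0 < p + s) :
    ∃ X : 𝔤, IsStationary X ∧ ¬ IsStable X := by
  refine ⟨(1 : ℝ) • b 0, h.isStationary, h.not_isStable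
    ((reducedStable_or_reducedUnstable one_pos (Or.inl rfl)).2 ?_)⟩
  rintro (⟨rfl, -, -, rfl⟩ | ⟨-, h1, -⟩)
  · simp at hps
  · linarith

theorem IsBiInvariant.linearisation_eq_zero (h : IsBiInvariant 𝔤) (X : 𝔤) :
    linearisation X = 0 := by
  ext Y
  refine ext_inner_left ℝ fun Z => ?_
  have h1 := h Y Z X
  have h2 := h X Z Y
  rw [← lie_skew Y X, inner_neg_left] at h2
  rw [inner_linearisation, LinearMap.zero_apply, inner_zero_right]
  linarith

omit [FiniteDimensional ℝ 𝔤] in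
theorem isBiInvariant_of_isLieAbelian (h : IsLieAbelian 𝔤) : IsBiInvariant 𝔤 := fun X Y Z => by
  simp [trivial_lie_zero]

theorem exists_isStationary_isStable (hdim : Module.finrank ℝ 𝔤 = 3) :
    ∃ X : 𝔤, X ≠ 0 ∧ IsStationary X ∧ IsStable X := by
  by_cases huni : ∀ Y : 𝔤, LinearMap.trace ℝ 𝔤 (LieAlgebra.ad ℝ 𝔤 Y) = 0
  · obtain ⟨b, μ₀, μ₁, μ₂, h⟩ := exists_isDiagonalFrame hdim huni
    exact h.exists_isStable
  · obtain ⟨v, c, hv, hc, htr⟩ := exists_trace_ad_eq_inner huni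
    -- The opposite direction -v makes the trace p + s = -c negative.
    obtain ⟨b, p, q, r, s, h, hps, -⟩ := exists_isAdaptedFrame_of_trace_ad hdim
      (v := -v) (by rwa [norm_neg]) (neg_ne_zero.2 hc.ne')
      (fun Y => by rw [htr, inner_neg_left, neg_mul_neg])
    exact h.exists_isStable hdim (by linarith)

theorem exists_isStationary_not_isStable_iff (hdim : Module.finrank ℝ 𝔤 = 3) :
    (∃ X : 𝔤, IsStationary X ∧ ¬ IsStable X) ↔ ¬ (IsLieAbelian 𝔤 ∨
      (Nonempty (𝔤 ≃ₗ⁅ℝ⁆ LieAlgebra.Orthogonal.so (Fin 3) ℝ) ∧ IsBiInvariant 𝔤)) := by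
  constructor
  · rintro ⟨X, hX, hun⟩ h
    have hbi : IsBiInvariant 𝔤 := h.elim isBiInvariant_of_isLieAbelian And.right
    exact hun ((isStable_iff hdim hX).2 (Or.inl (hbi.linearisation_eq_zero X)))
  · intro hn
    by_cases huni : ∀ Y : 𝔤, LinearMap.trace ℝ 𝔤 (LieAlgebra.ad ℝ 𝔤 Y) = 0
    · obtain ⟨b, μ₀, μ₁, μ₂, h⟩ := exists_isDiagonalFrame hdim huni
      refine h.exists_not_isStable ?_
      rintro ⟨rfl, rfl⟩
      by_cases hμ : μ₂ = 0
      · exact hn (Or.inl ⟨fun Y Z => by rw [h.lie_eq]; simp [hμ]⟩)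
      · exact hn (Or.inr ⟨h.nonempty_lieEquiv_so hμ, h.isBiInvariant⟩)
    · obtain ⟨v, c, hv, hc, htr⟩ := exists_trace_ad_eq_inner huni
      obtain ⟨b, p, q, r, s, h, hps, -⟩ := exists_isAdaptedFrame_of_trace_ad hdim hv hc.ne' htr
      exact h.not_isStable_of_trace_pos (by linarith)

end MetricLieAlgebra

end

theorem theorem1 {𝔤 : Type*} [MetricLieAlgebra 𝔤] [FiniteDimensional ℝ 𝔤]
    (hdim : Module.finrank ℝ 𝔤 = 3) :
    (∀ X : 𝔤, MetricLieAlgebra.IsStationary X →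
      (MetricLieAlgebra.IsStable X ↔
        MetricLieAlgebra.linearisation X = 0 ∨
        (0 ≤ MetricLieAlgebra.sigma 2 (MetricLieAlgebra.linearisation X) ∧
          MetricLieAlgebra.sigma 1 (MetricLieAlgebra.linearisation X) ≤ 0 ∧
          (0 < MetricLieAlgebra.sigma 2 (MetricLieAlgebra.linearisation X) ∨
            MetricLieAlgebra.sigma 1 (MetricLieAlgebra.linearisation X) < 0)))) ∧
    (∃ X : 𝔤, X ≠ 0 ∧ MetricLieAlgebra.IsStationary X ∧ MetricLieAlgebra.IsStable X) ∧
    ((∃ X : 𝔤, MetricLieAlgebra.IsStationary X ∧ ¬ MetricLieAlgebra.IsStable X) ↔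
      ¬ (IsLieAbelian 𝔤 ∨
        (Nonempty (𝔤 ≃ₗ⁅ℝ⁆ LieAlgebra.Orthogonal.so (Fin 3) ℝ) ∧
          MetricLieAlgebra.IsBiInvariant 𝔤))) :=
  ⟨fun _ hX => MetricLieAlgebra.isStable_iff hdim hX,
    MetricLieAlgebra.exists_isStationary_isStable hdim,
    MetricLieAlgebra.exists_isStationary_not_isStable_iff hdim⟩
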